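/- **Setting.** For $k_F>0$ let $B_F=\{p\in\mathbb Z^3:|p|\le k_F\}$, $B_F^c=\mathbb Z^3\setminus B_F$, $N=|B_F|$, $\hbar=N^{-1/3}$, $\kappa=k_FN^{-1/3}$. Let $\mathcal F$ be the fermionic Fock space over $L^2(\mathbb T^3)$, $\mathbb T^3=\mathbb R^3/(2\pi\mathbb Z^3)$, and let $a_p^*,a_p$ be the creation and annihilation operators of the plane waves with momentum $p\in\mathbb Z^3$. Put $\mathcal N=\sum_p a_p^*a_p$, $\mathcal N_h=\sum_{h\in B_F}a_h^*a_h$, $\mathcal N_p=\sum_{p\in B_F^c}a_p^*a_p$, $\mathcal N_\delta=\sum_{p:\,||p|-k_F|>N^{-\delta}}a_p^*a_p$ for $\delta>0$, and $$\mathbb H_0=\sum_{p\in\mathbb Z^3}|\hbar^2p^2-\kappa^2|\,a_p^*a_p,\qquad b(k)=\sum_{p\in B_F^c\cap(B_F+k)}a_{p-k}a_p,$$ $$d^*(k)=\sum_{p\in B_F^c\cap(B_F^c+k)}a_p^*a_{p-k}-\sum_{h\in B_F\cap(B_F-k)}a_h^*a_{h+k},$$ and, for a function $\hat V:\mathbb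 Z^3\to\mathbb R$ (the Fourier coefficients of the interaction potential), $$\mathcal E_1=\frac1{2N}\sum_{k\in\mathbb Z^3}\hat V(k)\,d^*(k)d(k),\qquad \mathcal E_2=\frac1{2N}\sum_{k\in\mathbb Z^3}\hat V(k)\big[d^*(k)b(-k)+\text{h.c.}\big].$$ Operator inequalities and expectation values are understood in the sense of quadratic forms. **Statement.** (i) Assume $\|\hat V\|_1=\sum_k|\hat V(k)|<\infty$ and $\hat V\ge0$. There is a constant $C>0$, depending only on $\hat V$, such that for all $k_F>0$ and all $\alpha\ge0$ $$\pm\mathcal E_2\le N^\alpha\mathcal E_1+CN^{-\alpha}\mathbb H_0$$ on all $\xi\in\mathcal F$ in the form domains of $\mathcal E_1$ and $\mathbb H_0$; in particular the series over $k$ defining $\langle\xi,\mathcal E_2\xi\rangle$ converges absolutely for such $\xi$. (ii) For every $\gamma$ with $131/208<\gamma<1$ there is $\varepsilon_0>0$ such that for every $0<\varepsilon<\varepsilon_0$ and every $\hat V\ge0$ with $\|\hat V\|_1<\infty$ there is a constant $C>0$ (depending on $\gamma,\varepsilon,\hat V$) such that, for all $k_F>0$ and all $\xi\in\chi(\mathcal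 N_h-\mathcal N_p=0)\mathcal F$ in the form domain of $\mathbb H_0$, the series for $\langle\xi,\mathcal E_1\xi\rangle$ and $\langle\xi,\mathcal E_2\xi\rangle$ converge absolutely and $$\langle\xi,(\mathcal E_1+\mathcal E_2)\xi\rangle\ \ge\ -CN^{-1+\varepsilon/4}\,\|(\mathcal N+1)^{3/2}\xi\|\,\|\mathcal N_{1/3-\varepsilon}^{1/2}\xi\|-CN^{5\varepsilon/4+\gamma/3-1}\,\|\mathcal N^{1/2}\xi\|^2-CN^{-\varepsilon/4}\,\|\mathbb H_0^{1/2}\xi\|^2 .$$ -/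

import Mathlib

open scoped InnerProductSpace

noncomputable section

namespace FermiGas

/-! ### Momenta and the Fermi ball -/

/-- Momenta on the torus of side `2π`: the lattice `ℤ³`. -/
abbrev Momentum := Fin 3 → ℤ

/-- The Euclidean length `|p|`. -/
def len (p : Momentum) : ℝ := √(∑ i, (p i : ℝ) ^ 2)

lemma fermiBall_finite (kF : ℝ) : {p : Momentum | len p ≤ kF}.Finite := by
  refine (Set.Finite.pi' (fun _ : Fin 3 => Set.finite_Icc (-⌈kF⌉) ⌈kF⌉)).subset ?_
  intro p hp i
  have h1 : |(p i : ℝ)| ≤ kF := by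
    refine le_trans ?_ hp
    rw [← Real.sqrt_sq_eq_abs]
    exact Real.sqrt_le_sqrt
      (Finset.single_le_sum (f := fun j => (p j : ℝ) ^ 2) (fun j _ => sq_nonneg _)
        (Finset.mem_univ i))
  have h2 := abs_le.1 (h1.trans (Int.le_ceil kF))
  constructor
  · exact_mod_cast h2.1
  · exact_mod_cast h2.2

/-- The Fermi ball `B_F = {p ∈ ℤ³ : |p| ≤ k_F}`. -/
def fermiBall (kF : ℝ) : Finset Momentum := (fermiBall_finite kF).toFinset

/-- The particle number `N = |B_F|`. -/
def particleNumber (kF : ℝ) : ℕ := (fermiBall kF).card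

/-- The effective Planck constant `ħ = N^{-1/3}`. -/
def hbar (kF : ℝ) : ℝ := (particleNumber kF : ℝ) ^ (-(1 / 3) : ℝ)

/-- The number `κ` determined by `k_F = κ N^{1/3}`. -/
def kappa (kF : ℝ) : ℝ := kF / (particleNumber kF : ℝ) ^ (1 / 3 : ℝ)

/-- The excitation energy `e(p) = |ħ² p² - κ²|`. -/
def excitationEnergy (kF : ℝ) (p : Momentum) : ℝ :=
  |hbar kF ^ 2 * len p ^ 2 - kappa kF ^ 2|

/-! ### Fermionic Fock space over `L²(𝕋³)`, in occupation number representation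

The Slater determinants `⋀_{p ∈ S} f_p` of plane waves, `S` running over the finite subsets of
`ℤ³` and the factors being arranged in lexicographic order, form an orthonormal basis of the
fermionic Fock space. A vector is identified with the square summable family of its coefficients
in this basis. -/

/-- Fermionic Fock space. -/
abbrev Fock := lp (fun _ : Finset Momentum => ℂ) 2

/-- The vacuum vector. -/
def vacuum : Fock := lp.single 2 (∅ : Finset Momentum) (1 : ℂ)

/-- The lexicographic order of the momenta. -/
def Precedes (p q : Momentum) : Prop := toLex p < toLex q

lemma not_precedes_self (p : Momentum) : ¬ Precedes p p := lt_irrefl (toLex p)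

lemma precedes_or {p q : Momentum} (h : p ≠ q) :
    (Precedes p q ∧ ¬ Precedes q p) ∨ (Precedes q p ∧ ¬ Precedes p q) := by
  rcases lt_or_gt_of_ne (toLex.injective.ne h) with h | h
  · exact Or.inl ⟨h, lt_asymm h⟩
  · exact Or.inr ⟨h, lt_asymm h⟩

open Classical in
/-- The sign picked up when the plane wave `f_p` is moved to its place among those in `S`. -/
def fermiSign (p : Momentum) (S : Finset Momentum) : ℂ :=
  (-1) ^ (S.filter (fun q => Precedes q p)).card

lemma norm_fermiSign (p : Momentum) (S : Finset Momentum) : ‖fermiSign p S‖ = 1 := by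
  simp [fermiSign]

lemma fermiSign_mul_self (p : Momentum) (S : Finset Momentum) :
    fermiSign p S * fermiSign p S = 1 := by
  simp [fermiSign, ← mul_pow]

lemma star_fermiSign (p : Momentum) (S : Finset Momentum) :
    star (fermiSign p S) = fermiSign p S := by
  simp [fermiSign]

/-- The coefficients of `a_p ξ`. -/
def annihilateFun (p : Momentum) (ξ : Finset Momentum → ℂ) : Finset Momentum → ℂ :=
  fun S => if p ∈ S then 0 else fermiSign p S * ξ (insert p S)

lemma insert_injOn (p : Momentum) :
    Function.Injective (fun S : {S : Finset Momentum // p ∉ S} => insert p S.1) := by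
  intro S T h
  apply Subtype.ext
  rw [← Finset.erase_insert S.2, ← Finset.erase_insert T.2]
  exact congrArg (fun U => Finset.erase U p) h

lemma norm_annihilateFun_sq (p : Momentum) (ξ : Finset Momentum → ℂ) :
    (fun S => ‖annihilateFun p ξ S‖ ^ 2) =
      Set.indicator {S : Finset Momentum | p ∉ S} (fun S => ‖ξ (insert p S)‖ ^ 2) := by
  funext S
  by_cases h : p ∈ S <;> simp [annihilateFun, h, norm_fermiSign]

lemma summable_fock (ξ : Fock) : Summable (fun S => ‖ξ S‖ ^ 2) := by
  have h := (lp.memℓp ξ).summable (by norm_num)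
  simpa using h

lemma norm_sq_fock (ξ : Fock) : ‖ξ‖ ^ 2 = ∑' S, ‖ξ S‖ ^ 2 := by
  have h := lp.norm_rpow_eq_tsum (p := 2) (by norm_num) ξ
  simpa using h

lemma memℓp_two {f : Finset Momentum → ℂ} (h : Summable (fun S => ‖f S‖ ^ 2)) :
    Memℓp f 2 := by
  refine memℓp_gen ?_
  simpa using h

lemma summable_annihilateFun (p : Momentum) (ξ : Fock) :
    Summable (fun S => ‖annihilateFun p ξ S‖ ^ 2) := by
  rw [norm_annihilateFun_sq]
  exact (summable_subtype_iff_indicator (s := {S : Finset Momentum | p ∉ S})).1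
    ((summable_fock ξ).comp_injective (insert_injOn p))

lemma tsum_annihilateFun_le (p : Momentum) (ξ : Fock) :
    ∑' S, ‖annihilateFun p ξ S‖ ^ 2 ≤ ∑' S, ‖ξ S‖ ^ 2 := by
  rw [norm_annihilateFun_sq, ← tsum_subtype]
  exact tsum_comp_le_tsum_of_inj (summable_fock ξ) (fun S => sq_nonneg _) (insert_injOn p)

/-- The annihilation operator `a_p` of the plane wave with momentum `p`. -/
def annihilate (p : Momentum) : Fock →L[ℂ] Fock :=
  LinearMap.mkContinuous
    { toFun := fun ξ => ⟨annihilateFun p ξ, memℓp_two (summable_annihilateFun p ξ)⟩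
      map_add' := by
        intro ξ η
        ext S
        change annihilateFun p (ξ + η : Fock) S = annihilateFun p ξ S + annihilateFun p η S
        by_cases h : p ∈ S <;> simp [annihilateFun, h, mul_add]
      map_smul' := by
        intro c ξ
        ext S
        change annihilateFun p (c • ξ : Fock) S = c * annihilateFun p ξ S
        by_cases h : p ∈ S <;> simp [annihilateFun, h, mul_left_comm] }
    1 (by
      intro ξ
      rw [one_mul]
      refine le_of_sq_le_sq ?_ (norm_nonneg _)
      rw [norm_sq_fock, norm_sq_fock]
      exact tsum_annihilateFun_le p ξ)

/-- The creation operator `a_p^*`. -/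
def create (p : Momentum) : Fock →L[ℂ] Fock := ContinuousLinearMap.adjoint (annihilate p)

lemma annihilate_apply (p : Momentum) (ξ : Fock) (S : Finset Momentum) :
    annihilate p ξ S = if p ∈ S then 0 else fermiSign p S * ξ (insert p S) := rfl

lemma fermiSign_insert_self (p : Momentum) (S : Finset Momentum) :
    fermiSign p (insert p S) = fermiSign p S := by
  simp [fermiSign, Finset.filter_insert, not_precedes_self]

lemma annihilate_single (p : Momentum) (S : Finset Momentum) :
    annihilate p (lp.single 2 S (1 : ℂ)) =
      if p ∈ S then lp.single 2 (S.erase p) (fermiSign p S) else 0 := by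
  ext T
  rw [annihilate_apply]
  by_cases hT : p ∈ T
  · rw [if_pos hT]
    split_ifs with hS
    · have hne : T ≠ S.erase p := by rintro rfl; simp at hT
      simp [lp.single_apply, hne]
    · rfl
  · rw [if_neg hT]
    split_ifs with hS
    · by_cases hTS : T = S.erase p
      · subst hTS
        rw [Finset.insert_erase hS, lp.single_apply_self, lp.single_apply_self, mul_one,
          ← fermiSign_insert_self, Finset.insert_erase hS]
      · have h2 : insert p T ≠ S := by
          rintro rfl
          exact hTS (Finset.erase_insert hT).symm
        simp [lp.single_apply, hTS, h2]
    · have h2 : insert p T ≠ S := by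
        rintro rfl
        simp at hS
      simp [lp.single_apply, h2]

lemma create_apply (p : Momentum) (ξ : Fock) (S : Finset Momentum) :
    create p ξ S = if p ∈ S then fermiSign p S * ξ (S.erase p) else 0 := by
  have h1 : create p ξ S = ⟪lp.single 2 S (1 : ℂ), create p ξ⟫_ℂ := by
    rw [lp.inner_single_left]
    simp
  rw [h1, create, ContinuousLinearMap.adjoint_inner_right, annihilate_single]
  split_ifs with h
  · rw [lp.inner_single_left]
    have := star_fermiSign p S
    simp only [RCLike.star_def] at this
    simp [this, mul_comm]
  · simp

lemma create_annihilate_apply (p : Momentum) (ξ : Fock) (S : Finset Momentum) :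
    create p (annihilate p ξ) S = if p ∈ S then ξ S else 0 := by
  rw [create_apply]
  split_ifs with h
  · rw [annihilate_apply, if_neg (Finset.notMem_erase p S), Finset.insert_erase h, ← mul_assoc,
      ← fermiSign_insert_self p (S.erase p), Finset.insert_erase h, fermiSign_mul_self, one_mul]
  · rfl

lemma annihilate_vacuum (p : Momentum) : annihilate p vacuum = 0 := by
  ext S
  simp [annihilate_apply, vacuum]

open Classical in
lemma fermiSign_insert {p q : Momentum} {S : Finset Momentum} (hp : p ∉ S) :
    fermiSign q (insert p S) = (if Precedes p q then -1 else 1) * fermiSign q S := by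
  unfold fermiSign
  rw [Finset.filter_insert]
  split_ifs with h
  · rw [Finset.card_insert_of_notMem (by simp [hp]), pow_succ']
  · rw [one_mul]

/-- Canonical anticommutation relations, first part. -/
lemma annihilate_annihilate (p q : Momentum) (ξ : Fock) :
    annihilate p (annihilate q ξ) + annihilate q (annihilate p ξ) = 0 := by
  ext S
  change annihilate p (annihilate q ξ) S + annihilate q (annihilate p ξ) S = 0
  simp only [annihilate_apply]
  rcases eq_or_ne p q with rfl | hpq
  · simp
  by_cases hp : p ∈ S
  · simp [hp]
  by_cases hq : q ∈ S
  · simp [hq]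
  rw [if_neg hp, if_neg hq, if_neg (by simp [hpq.symm, hq]), if_neg (by simp [hpq, hp]),
    fermiSign_insert hp, fermiSign_insert hq, Finset.insert_comm q p]
  rcases precedes_or hpq with ⟨h, h2⟩ | ⟨h, h2⟩
  · rw [if_pos h, if_neg h2]; ring
  · rw [if_pos h, if_neg h2]; ring

/-- Canonical anticommutation relations, second part. -/
lemma annihilate_create (p q : Momentum) (ξ : Fock) :
    annihilate p (create q ξ) + create q (annihilate p ξ) = if p = q then ξ else 0 := by
  ext S
  change annihilate p (create q ξ) S + create q (annihilate p ξ) S = _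
  rcases eq_or_ne p q with rfl | hpq
  · rw [create_annihilate_apply, annihilate_apply, create_apply, if_pos rfl]
    by_cases hp : p ∈ S
    · simp [hp]
    · rw [if_neg hp, if_neg hp, if_pos (Finset.mem_insert_self p S), Finset.erase_insert hp,
        fermiSign_insert_self, ← mul_assoc, fermiSign_mul_self, one_mul, add_zero]
  · rw [if_neg hpq, annihilate_apply, create_apply, create_apply, annihilate_apply]
    change _ = (0 : ℂ)
    by_cases hq : q ∈ S
    · by_cases hp : p ∈ S
      · simp [hp, hpq]
      · obtain ⟨T, hqT, rfl⟩ : ∃ T, q ∉ T ∧ S = insert q T :=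
          ⟨S.erase q, by simp, (Finset.insert_erase hq).symm⟩
        have hpT : p ∉ T := fun h => hp (Finset.mem_insert_of_mem h)
        rw [if_neg hp, if_pos (by simp), if_pos hq, Finset.erase_insert hqT, if_neg hpT,
          Finset.insert_comm p q, Finset.erase_insert (by simp [hpq.symm, hqT]),
          fermiSign_insert_self, fermiSign_insert_self, fermiSign_insert hqT,
          fermiSign_insert hpT]
        rcases precedes_or hpq with ⟨h, h2⟩ | ⟨h, h2⟩
        · rw [if_pos h, if_neg h2]; ring
        · rw [if_pos h, if_neg h2]; ring
    · simp [hq, hpq.symm]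

/-! ### The operators of the correlation Hamiltonian

An inequality between operators is an inequality between their quadratic forms. -/

/-- The set `B_F^c ∩ (B_F + k)`. -/
def lune (kF : ℝ) (k : Momentum) : Finset Momentum :=
  ((fermiBall kF).image (fun h => h + k)).filter (fun p => p ∉ fermiBall kF)

/-- The pair operator `b(k) = ∑ a_{p-k} a_p` over `p ∈ B_F^c ∩ (B_F + k)`. -/
def pairOp (kF : ℝ) (k : Momentum) : Fock →L[ℂ] Fock :=
  ∑ p ∈ lune kF k, annihilate (p - k) ∘L annihilate p

/-- The coefficients of `d(k) ξ` in the basis of Slater determinants, where `d(k)` is the adjoint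
of `d^*(k) = ∑ a_p^* a_{p-k} - ∑ a_h^* a_{h+k}`, that is,
`d(k) = ∑ a_{p-k}^* a_p - ∑ a_{h+k}^* a_h`, with `p ∈ B_F^c ∩ (B_F^c + k)` and
`h ∈ B_F ∩ (B_F - k)`. For each coefficient only finitely many terms are nonzero. -/
def nonBosonizableFun (kF : ℝ) (k : Momentum) (ξ : Fock) : Finset Momentum → ℂ := fun S =>
  (∑' p : {p : Momentum // p ∉ fermiBall kF ∧ p - k ∉ fermiBall kF},
      create (p.1 - k) (annihilate p.1 ξ) S)
    - ∑ h ∈ fermiBall kF with h + k ∈ fermiBall kF, create (h + k) (annihilate h ξ) S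

/-- The (maximal) domain of `d(k)`. -/
def nonBosonizableDomain (kF : ℝ) (k : Momentum) : Set Fock :=
  {ξ | Memℓp (nonBosonizableFun kF k ξ) 2}

open Classical in
/-- The vector `d(k) ξ`, for `ξ` in the domain of `d(k)` (and `0` otherwise). -/
def nonBosonizable (kF : ℝ) (k : Momentum) (ξ : Fock) : Fock :=
  if h : Memℓp (nonBosonizableFun kF k ξ) 2 then ⟨nonBosonizableFun kF k ξ, h⟩ else 0

/-- The form domain of `ℰ₁`: the vectors on which all the operators `d(k)` that occur in `ℰ₁` are
defined and `⟨ξ, ℰ₁ ξ⟩` is finite. -/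
def E1Domain (V : Momentum → ℝ) (kF : ℝ) : Set Fock :=
  {ξ | (∀ k, V k ≠ 0 → ξ ∈ nonBosonizableDomain kF k) ∧
    Summable (fun k => V k * ‖nonBosonizable kF k ξ‖ ^ 2)}

/-- `⟨ξ, ℰ₁ ξ⟩`, where `ℰ₁ = (2N)⁻¹ ∑ V̂(k) d^*(k) d(k)`. -/
def E1Form (V : Momentum → ℝ) (kF : ℝ) (ξ : Fock) : ℝ :=
  1 / (2 * (particleNumber kF : ℝ)) * ∑' k, V k * ‖nonBosonizable kF k ξ‖ ^ 2

/-- `⟨ξ, (d^*(k) b(-k) + h.c.) ξ⟩ = ⟨d(k) ξ, b(-k) ξ⟩ + ⟨b(-k) ξ, d(k) ξ⟩`. -/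
def couplingForm (kF : ℝ) (k : Momentum) (ξ : Fock) : ℝ :=
  2 * (⟪nonBosonizable kF k ξ, pairOp kF (-k) ξ⟫_ℂ).re

/-- `⟨ξ, ℰ₂ ξ⟩`, where `ℰ₂ = (2N)⁻¹ ∑ V̂(k) [d^*(k) b(-k) + h.c.]`. -/
def E2Form (V : Momentum → ℝ) (kF : ℝ) (ξ : Fock) : ℝ :=
  1 / (2 * (particleNumber kF : ℝ)) * ∑' k, V k * couplingForm kF k ξ

/-- The form domain of the kinetic energy `ℍ₀ = ∑ e(p) a_p^* a_p`. -/
def kineticDomain (kF : ℝ) : Set Fock :=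
  {ξ | Summable (fun p => excitationEnergy kF p * ‖annihilate p ξ‖ ^ 2)}

/-- `⟨ξ, ℍ₀ ξ⟩ = ‖ℍ₀^{1/2} ξ‖²`. -/
def kineticForm (kF : ℝ) (ξ : Fock) : ℝ :=
  ∑' p, excitationEnergy kF p * ‖annihilate p ξ‖ ^ 2

/-- `⟨ξ, 𝒩 ξ⟩ = ‖𝒩^{1/2} ξ‖²` for the number operator `𝒩 = ∑ a_p^* a_p`. -/
def numberForm (ξ : Fock) : ℝ := ∑' p, ‖annihilate p ξ‖ ^ 2

/-- `⟨ξ, 𝒩_δ ξ⟩ = ‖𝒩_δ^{1/2} ξ‖²` for the gapped number operator `𝒩_δ = ∑ a_p^* a_p`, the sum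
running over the momenta with `||p| - k_F| > N^{-δ}`. -/
def gappedNumberForm (kF δ : ℝ) (ξ : Fock) : ℝ :=
  ∑' p : {p : Momentum // (particleNumber kF : ℝ) ^ (-δ) < |len p - kF|}, ‖annihilate p.1 ξ‖ ^ 2

/-- `‖(𝒩 + 1)^{3/2} ξ‖² = ⟨ξ, (𝒩 + 1)³ ξ⟩`; the number operator is diagonal in the basis of Slater
determinants, with the eigenvalue `|S|` on the one with momenta `S`. -/
def numberCubedForm (ξ : Fock) : ℝ := ∑' S : Finset Momentum, ((S.card : ℝ) + 1) ^ 3 * ‖ξ S‖ ^ 2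

/-- The eigenspace `χ(𝒩_h - 𝒩_p = 0) ℱ`, spanned by the Slater determinants with as many momenta
inside the Fermi ball (holes) as outside (particles). -/
def balancedSector (kF : ℝ) : Set Fock :=
  {ξ | ∀ S : Finset Momentum, ξ S ≠ 0 →
    (S.filter (fun p => p ∈ fermiBall kF)).card = (S.filter (fun p => p ∉ fermiBall kF)).card}

end FermiGas

end

/-!
Since `V̂ ≥ 0`, Young's inequality applied to each `2 Re ⟨d(k) ξ, b(-k) ξ⟩` gives
`±ℰ₂ ≤ s ℰ₁ + s⁻¹ (2N)⁻¹ ∑ V̂(k) ‖b(-k) ξ‖²` for every `s > 0`. By Cauchy–Schwarz `‖b(k) ξ‖²` is at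
most `⟨ℍ₀⟩` times the sum over the lune `B_F^c ∩ (B_F + k)` of the inverse energy gaps
`(ħ² (p² - (p - k)²))⁻¹`. Cutting the lune into slabs of comparable gap, each of which lies
in a cylindrical shell with few lattice points, bounds this sum by `C N`; with `s = N^α` this is
the first part.

For the second part take `s = N^{ε/4}`, so that `ℰ₁` has to be bounded from above. On the balanced
sector `d(0) = 𝒩_p - 𝒩_h = 0`. For `k ≠ 0` the operator `d(k)` is a sum of hops `q + k → q`. Hops
with one end outside the shell `||p| - k_F| ≤ N^{-1/3+ε}` are counted by `𝒩_{1/3-ε}`. Hops with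
both ends inside are few: their end points lie on `N^{O(ε)}` circles cut out by two spheres with
centres `0` and `k`, and the number of lattice points on such a circle is at most the number of
representations of an integer by a positive definite binary quadratic form, hence `N^{o(1)}` by
the divisor bound.
-/

noncomputable section

namespace FermiGas

/-! ### Lattice points in cylindrical shells -/

open MeasureTheory

lemma card_mul_measure_ball_le {ι E : Type*} [NormedAddCommGroup E] [MeasurableSpace E]
    [BorelSpace E] (μ : Measure E) [μ.IsAddLeftInvariant] {r : ℝ} {F : Finset ι} {f : ι → E}
    (hsep : (F : Set ι).Pairwise fun i j => 2 * r ≤ dist (f i) (f j)) {T : Set E}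
    (hT : ∀ i ∈ F, Metric.ball (f i) r ⊆ T) :
    F.card * μ (Metric.ball 0 r) ≤ μ T := by
  have hdisj : (F : Set ι).PairwiseDisjoint fun i => Metric.ball (f i) r := fun i hi j hj hij =>
    Metric.ball_disjoint_ball (by linarith [hsep hi hj hij])
  calc F.card * μ (Metric.ball 0 r) = ∑ i ∈ F, μ (Metric.ball (f i) r) := by
        rw [← nsmul_eq_mul, ← Finset.sum_const]
        refine Finset.sum_congr rfl fun i _ => ?_
        rw [← measure_preimage_add μ (f i) (Metric.ball (f i) r), preimage_add_ball, sub_self]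
    _ = μ (⋃ i ∈ F, Metric.ball (f i) r) :=
        (measure_biUnion_finset hdisj fun _ _ => measurableSet_ball).symm
    _ ≤ μ T := measure_mono (Set.iUnion₂_subset hT)

section InnerProductSpace

variable {E : Type*} [NormedAddCommGroup E] [InnerProductSpace ℝ E]

/-- The distance of `x` from the axis `ℝ e`. -/
def axisDist (e x : E) : ℝ := ‖(ℝ ∙ e)ᗮ.starProjection x‖

lemma axisDist_nonneg (e x : E) : 0 ≤ axisDist e x := norm_nonneg _

lemma axisDist_sq {e : E} (he : ‖e‖ = 1) (x : E) :
    axisDist e x ^ 2 = ‖x‖ ^ 2 - ⟪e, x⟫_ℝ ^ 2 := by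
  rw [Submodule.norm_sq_eq_add_norm_sq_starProjection x (ℝ ∙ e),
    Submodule.starProjection_unit_singleton ℝ he, norm_smul, he, mul_one, Real.norm_eq_abs, sq_abs,
    add_sub_cancel_left, axisDist]

lemma abs_axisDist_sub_le (e x y : E) : |axisDist e x - axisDist e y| ≤ ‖x - y‖ := by
  refine (abs_norm_sub_norm_le _ _).trans ?_
  rw [← map_sub]
  exact Submodule.norm_starProjection_apply_le _ _

lemma axisDist_sub_smul (e x : E) (c : ℝ) : axisDist e (x - c • e) = axisDist e x := by
  have he : (ℝ ∙ e)ᗮ.starProjection e = 0 :=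
    Submodule.starProjection_orthogonal_apply_eq_zero (Submodule.mem_span_singleton_self e)
  rw [axisDist, map_sub, map_smul, he, smul_zero, sub_zero, axisDist]

/-- The points whose coordinate along the unit vector `e` lies in `[t₁, t₂]` and whose distance
from the axis `ℝ e` lies in `[r₁, r₂]`. -/
def cylindricalShell (e : E) (t₁ t₂ r₁ r₂ : ℝ) : Set E :=
  {x | ⟪e, x⟫_ℝ ∈ Set.Icc t₁ t₂ ∧ axisDist e x ∈ Set.Icc r₁ r₂}

lemma ball_subset_cylindricalShell {e x : E} (he : ‖e‖ = 1) {t₁ t₂ r₁ r₂ s : ℝ}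
    (hx : x ∈ cylindricalShell e t₁ t₂ r₁ r₂) :
    Metric.ball x s ⊆ cylindricalShell e (t₁ - s) (t₂ + s) (max (r₁ - s) 0) (r₂ + s) := by
  intro y hy
  rw [Metric.mem_ball, dist_eq_norm] at hy
  have ht : |⟪e, y⟫_ℝ - ⟪e, x⟫_ℝ| ≤ s := by
    rw [← inner_sub_right]
    exact (abs_real_inner_le_norm _ _).trans (by rw [he, one_mul]; exact hy.le)
  have hr := abs_le.1 ((abs_axisDist_sub_le e y x).trans hy.le)
  obtain ⟨⟨h₁, h₂⟩, h₃, h₄⟩ := hx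
  refine ⟨⟨?_, ?_⟩, max_le ?_ (axisDist_nonneg e y), ?_⟩ <;> linarith [abs_le.1 ht, hr]

end InnerProductSpace

lemma volume_annulus {r₁ r₂ : ℝ} (h₁ : 0 ≤ r₁) (h₁₂ : r₁ ≤ r₂) :
    volume {x : EuclideanSpace ℝ (Fin 2) | ‖x‖ ∈ Set.Icc r₁ r₂} =
      ENNReal.ofReal (Real.pi * (r₂ ^ 2 - r₁ ^ 2)) := by
  have hset : {x : EuclideanSpace ℝ (Fin 2) | ‖x‖ ∈ Set.Icc r₁ r₂} =
      Metric.closedBall 0 r₂ \ Metric.ball 0 r₁ := by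
    ext x
    simp [and_comm]
  rw [hset, measure_sdiff
      (Metric.ball_subset_closedBall.trans (Metric.closedBall_subset_closedBall h₁₂))
      measurableSet_ball.nullMeasurableSet measure_ball_lt_top.ne,
    EuclideanSpace.volume_closedBall_fin_two, EuclideanSpace.volume_ball_fin_two,
    ← ENNReal.ofReal_pow (h₁.trans h₁₂), ← ENNReal.ofReal_pow h₁,
    ← ENNReal.ofReal_mul (by positivity), ← ENNReal.ofReal_mul (by positivity),
    ← ENNReal.ofReal_sub _ (by positivity)]
  congr 1
  ring

lemma exists_measurePreserving_inner_axisDist {e : EuclideanSpace ℝ (Fin 3)} (he : ‖e‖ = 1) :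
    ∃ φ : EuclideanSpace ℝ (Fin 3) → ℝ × EuclideanSpace ℝ (Fin 2),
      MeasurePreserving φ volume volume ∧ ∀ x, (φ x).1 = ⟪e, x⟫_ℝ ∧ ‖(φ x).2‖ = axisDist e x := by
  have hor : Orthonormal ℝ (({0} : Set (Fin 3)).domRestrict (fun _ => e)) :=
    ⟨fun _ => he, fun i j hij => absurd (Subsingleton.elim i j) hij⟩
  obtain ⟨b, hb⟩ := hor.exists_orthonormalBasis_extension_of_card_eq (by simp)
  have hsplit := ((MeasurePreserving.id (volume : Measure ℝ)).prod
    (PiLp.volume_preserving_toLp (Fin 2))).comp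
      ((volume_preserving_piFinSuccAbove (fun _ : Fin 3 => ℝ) 0).comp
        (PiLp.volume_preserving_ofLp (Fin 3)))
  refine ⟨_, hsplit.comp b.measurePreserving_repr, fun x => ?_⟩
  have hfst : b.repr x 0 = ⟪e, x⟫_ℝ := by rw [b.repr_apply_apply, hb 0 rfl]
  refine ⟨hfst, ?_⟩
  rw [← sq_eq_sq₀ (norm_nonneg _) (axisDist_nonneg e x), axisDist_sq he, ← b.repr.norm_map,
    ← hfst, EuclideanSpace.real_norm_sq_eq, EuclideanSpace.real_norm_sq_eq, Fin.sum_univ_two,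
    Fin.sum_univ_three, add_assoc, add_sub_cancel_left]
  rfl

lemma volume_cylindricalShell {e : EuclideanSpace ℝ (Fin 3)} (he : ‖e‖ = 1) (t₁ t₂ : ℝ)
    {r₁ r₂ : ℝ} (h₁ : 0 ≤ r₁) (h₁₂ : r₁ ≤ r₂) :
    volume (cylindricalShell e t₁ t₂ r₁ r₂) =
      ENNReal.ofReal (t₂ - t₁) * ENNReal.ofReal (Real.pi * (r₂ ^ 2 - r₁ ^ 2)) := by
  obtain ⟨φ, hφ, hcoord⟩ := exists_measurePreserving_inner_axisDist he
  have hset : cylindricalShell e t₁ t₂ r₁ r₂ =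
      φ ⁻¹' (Set.Icc t₁ t₂ ×ˢ {x | ‖x‖ ∈ Set.Icc r₁ r₂}) := by
    ext x
    simp only [cylindricalShell, Set.mem_ofPred_eq, Set.mem_preimage, Set.mem_prod, hcoord]
  have hmeas : MeasurableSet (Set.Icc t₁ t₂ ×ˢ
      {x : EuclideanSpace ℝ (Fin 2) | ‖x‖ ∈ Set.Icc r₁ r₂}) :=
    measurableSet_Icc.prod (measurable_norm measurableSet_Icc)
  rw [hset, hφ.measure_preimage hmeas.nullMeasurableSet, Measure.volume_eq_prod,
    Measure.prod_prod, Real.volume_Icc, volume_annulus h₁ h₁₂]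

lemma card_le_of_mem_cylindricalShell {ι : Type*} {e : EuclideanSpace ℝ (Fin 3)} (he : ‖e‖ = 1)
    {t₁ t₂ r₁ r₂ : ℝ} (ht : t₁ ≤ t₂) (h₁ : 0 ≤ r₁) (h₁₂ : r₁ ≤ r₂) {F : Finset ι}
    {f : ι → EuclideanSpace ℝ (Fin 3)}
    (hsep : (F : Set ι).Pairwise fun i j => 1 ≤ dist (f i) (f j))
    (hF : ∀ i ∈ F, f i ∈ cylindricalShell e t₁ t₂ r₁ r₂) :
    (F.card : ℝ) ≤ 12 * (t₂ - t₁ + 1) * (r₂ ^ 2 - r₁ ^ 2 + r₂ + 1) := by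
  have hr : max (r₁ - 1 / 2) 0 ≤ r₂ + 1 / 2 := max_le (by linarith) (by linarith)
  have harea : (r₂ + 1 / 2) ^ 2 - max (r₁ - 1 / 2) 0 ^ 2 ≤ 2 * (r₂ ^ 2 - r₁ ^ 2 + r₂ + 1) := by
    rcases max_cases (r₁ - 1 / 2) 0 with ⟨hmax, _⟩ | ⟨hmax, _⟩ <;> rw [hmax] <;> nlinarith
  have hmeas := card_mul_measure_ball_le volume (r := 1 / 2) (by norm_num; exact hsep)
    fun i hi => ball_subset_cylindricalShell he (hF i hi)
  rw [volume_cylindricalShell he _ _ (le_max_right _ _) hr, EuclideanSpace.volume_ball_fin_three,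
    ← ENNReal.ofReal_mul (by linarith), ← ENNReal.ofReal_pow (by norm_num),
    ← ENNReal.ofReal_mul (by positivity), ← ENNReal.ofReal_natCast,
    ← ENNReal.ofReal_mul (by positivity), ENNReal.ofReal_le_ofReal_iff] at hmeas
  · have hcancel : (F.card : ℝ) ≤
        6 * ((t₂ - t₁ + 1) * ((r₂ + 1 / 2) ^ 2 - max (r₁ - 1 / 2) 0 ^ 2)) := by
      refine le_of_mul_le_mul_right ?_ (by positivity : 0 < Real.pi / 6)
      linarith
    nlinarith [mul_le_mul_of_nonneg_left harea (by linarith : 0 ≤ t₂ - t₁ + 1)]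
  · have : 0 ≤ (r₂ + 1 / 2) ^ 2 - max (r₁ - 1 / 2) 0 ^ 2 :=
      sub_nonneg.2 (pow_le_pow_left₀ (le_max_right _ _) hr 2)
    exact mul_nonneg (by linarith) (by positivity)

/-! ### Momenta and the Fermi ball -/

/-- The embedding of the momenta into Euclidean space. -/
def toE : Momentum →+ EuclideanSpace ℝ (Fin 3) where
  toFun p := WithLp.toLp 2 fun i => (p i : ℝ)
  map_zero' := by ext; simp
  map_add' p q := by ext; simp

lemma norm_toE (p : Momentum) : ‖toE p‖ = len p := by
  rw [EuclideanSpace.norm_eq]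
  simp [len, toE]

lemma toE_zsmul (m : ℤ) (p : Momentum) : toE (m • p) = (m : ℝ) • toE p := by
  rw [map_zsmul, Int.cast_smul_eq_zsmul]

lemma len_nonneg (p : Momentum) : 0 ≤ len p := Real.sqrt_nonneg _

lemma len_zero : len 0 = 0 := by simp [len]

lemma len_sub_le (p q : Momentum) : len (p - q) ≤ len p + len q := by
  simpa only [← norm_toE, map_sub] using norm_sub_le (toE p) (toE q)

lemma abs_apply_le_len (p : Momentum) (i : Fin 3) : |(p i : ℝ)| ≤ len p := by
  rw [← norm_toE]
  exact PiLp.norm_apply_le (toE p) i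

/-- The integer `|p|²`. -/
def lenSq (p : Momentum) : ℤ := ∑ i, p i ^ 2

lemma len_sq (p : Momentum) : len p ^ 2 = (lenSq p : ℝ) := by
  rw [len, Real.sq_sqrt (Finset.sum_nonneg fun i _ => sq_nonneg _)]
  simp [lenSq]

lemma lenSq_pos {p : Momentum} (hp : p ≠ 0) : 0 < lenSq p := by
  obtain ⟨i, hi⟩ := Function.ne_iff.1 hp
  exact Finset.sum_pos' (fun j _ => sq_nonneg _) ⟨i, Finset.mem_univ i, sq_pos_of_ne_zero hi⟩

lemma one_le_len {p : Momentum} (hp : p ≠ 0) : 1 ≤ len p := by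
  rw [← one_le_sq_iff₀ (len_nonneg p), len_sq]
  exact_mod_cast lenSq_pos hp

lemma one_le_dist_toE {p q : Momentum} (h : p ≠ q) : 1 ≤ dist (toE p) (toE q) := by
  rw [dist_eq_norm, ← map_sub, norm_toE]
  exact one_le_len (sub_ne_zero.2 h)

lemma mem_fermiBall {kF : ℝ} {p : Momentum} : p ∈ fermiBall kF ↔ len p ≤ kF := by
  simp [fermiBall]

lemma mem_lune {kF : ℝ} {k p : Momentum} : p ∈ lune kF k ↔ len (p - k) ≤ kF ∧ kF < len p := by
  simp only [lune, Finset.mem_filter, Finset.mem_image, mem_fermiBall, not_le]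
  refine and_congr_left fun _ => ⟨?_, fun h => ⟨p - k, h, sub_add_cancel p k⟩⟩
  rintro ⟨h, hh, rfl⟩
  rwa [add_sub_cancel_right]

lemma card_lune_le (kF : ℝ) (k : Momentum) : (lune kF k).card ≤ particleNumber kF :=
  (Finset.card_filter_le _ _).trans Finset.card_image_le

lemma one_le_particleNumber {kF : ℝ} (h : 0 ≤ kF) : 1 ≤ (particleNumber kF : ℝ) := by
  rw [Nat.one_le_cast]
  exact Finset.card_pos.2 ⟨0, mem_fermiBall.2 (len_zero.trans_le h)⟩

lemma card_Icc_neg_self (m : ℕ) :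
    (Finset.Icc (fun _ => -m : Momentum) fun _ => m).card = (2 * m + 1) ^ 3 := by
  rw [Pi.card_Icc]
  simp only [Int.card_Icc, Finset.prod_const, Finset.card_univ, Fintype.card_fin]
  congr 1
  omega

lemma particleNumber_le {kF : ℝ} (h : 0 ≤ kF) : (particleNumber kF : ℝ) ≤ (2 * kF + 1) ^ 3 := by
  have hsub : fermiBall kF ⊆ Finset.Icc (fun _ => -⌊kF⌋₊) fun _ => ⌊kF⌋₊ := by
    intro p hp
    have hcoord (i : Fin 3) : |p i| ≤ ⌊kF⌋₊ := by
      rw [Int.natCast_floor_eq_floor h, Int.le_floor, Int.cast_abs]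
      exact (abs_apply_le_len p i).trans (mem_fermiBall.1 hp)
    exact Finset.mem_Icc.2 ⟨fun i => (abs_le.1 (hcoord i)).1, fun i => (abs_le.1 (hcoord i)).2⟩
  calc (particleNumber kF : ℝ) ≤ (2 * ⌊kF⌋₊ + 1 : ℝ) ^ 3 := by
        exact_mod_cast (Finset.card_le_card hsub).trans_eq (card_Icc_neg_self _)
    _ ≤ (2 * kF + 1) ^ 3 := by
        gcongr
        exact Nat.floor_le h

lemma le_particleNumber {kF : ℝ} (h : 0 ≤ kF) : (kF / 2) ^ 3 ≤ particleNumber kF := by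
  set m := ⌊kF / 2⌋₊
  have hm : (m : ℝ) ≤ kF / 2 := Nat.floor_le (by positivity)
  have hm' : kF / 2 < m + 1 := Nat.lt_floor_add_one _
  have hsub : (Finset.Icc (fun _ => -m : Momentum) fun _ => m) ⊆ fermiBall kF := by
    intro p hp
    obtain ⟨hlow, hupp⟩ := Finset.mem_Icc.1 hp
    have hcoord (i : Fin 3) : (p i : ℝ) ^ 2 ≤ (kF / 2) ^ 2 := by
      have hlow' : -(m : ℝ) ≤ p i := by exact_mod_cast hlow i
      have hupp' : (p i : ℝ) ≤ m := by exact_mod_cast hupp i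
      exact sq_le_sq' (by linarith) (by linarith)
    rw [mem_fermiBall, len]
    refine Real.sqrt_le_iff.2 ⟨h, ?_⟩
    rw [Fin.sum_univ_three]
    nlinarith [hcoord 0, hcoord 1, hcoord 2]
  calc (kF / 2) ^ 3 ≤ (2 * m + 1 : ℝ) ^ 3 := by
        gcongr
        linarith [m.cast_nonneg (α := ℝ)]
    _ ≤ (particleNumber kF : ℝ) := by
        exact_mod_cast (card_Icc_neg_self m).symm.trans_le (Finset.card_le_card hsub)

lemma one_le_rpow_particleNumber {kF : ℝ} (h : 0 ≤ kF) {s : ℝ} (hs : 0 ≤ s) :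
    1 ≤ (particleNumber kF : ℝ) ^ s :=
  Real.one_le_rpow (one_le_particleNumber h) hs

lemma rpow_third_pow_three {x : ℝ} (hx : 0 ≤ x) : (x ^ (1 / 3 : ℝ)) ^ 3 = x := by
  rw [one_div]
  exact Real.rpow_inv_natCast_pow hx three_ne_zero

lemma kF_le {kF : ℝ} (h : 0 ≤ kF) : kF ≤ 2 * (particleNumber kF : ℝ) ^ (1 / 3 : ℝ) := by
  rw [← div_le_iff₀' two_pos, ← pow_le_pow_iff_left₀ (by positivity) (by positivity) three_ne_zero,
    rpow_third_pow_three (Nat.cast_nonneg _)]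
  exact le_particleNumber h

lemma kF_add_one_le {kF : ℝ} (h : 0 ≤ kF) :
    kF + 1 ≤ 3 * (particleNumber kF : ℝ) ^ (1 / 3 : ℝ) := by
  linarith [kF_le h, one_le_rpow_particleNumber h (s := 1 / 3) (by norm_num)]

lemma rpow_third_particleNumber_le {kF : ℝ} (h : 0 ≤ kF) :
    (particleNumber kF : ℝ) ^ (1 / 3 : ℝ) ≤ 2 * kF + 1 := by
  rw [← pow_le_pow_iff_left₀ (by positivity) (by positivity) three_ne_zero,
    rpow_third_pow_three (Nat.cast_nonneg _)]
  exact particleNumber_le h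

/-! ### The energy denominators of the lune -/

/-- The integer `|p|² - |p - k|²`, which is `(e(p) + e(p - k)) / ħ²` for `p` in the lune. -/
def luneGap (k p : Momentum) : ℤ := lenSq p - lenSq (p - k)

lemma luneGap_eq (k p : Momentum) : (luneGap k p : ℝ) = len p ^ 2 - len (p - k) ^ 2 := by
  rw [len_sq, len_sq, luneGap, Int.cast_sub]

lemma luneGap_eq_inner (k p : Momentum) :
    (luneGap k p : ℝ) = 2 * ⟪toE p, toE k⟫_ℝ - len k ^ 2 := by
  rw [luneGap_eq, ← norm_toE (p - k), map_sub, norm_sub_sq_real, norm_toE, norm_toE]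
  ring

lemma one_le_luneGap {kF : ℝ} {k p : Momentum} (hp : p ∈ lune kF k) :
    (1 : ℝ) ≤ luneGap k p := by
  have hpos : (0 : ℝ) < luneGap k p := by
    rw [luneGap_eq, sub_pos]
    exact pow_lt_pow_left₀ ((mem_lune.1 hp).1.trans_lt (mem_lune.1 hp).2) (len_nonneg _) two_ne_zero
  exact_mod_cast hpos

/-- The unit vector in the direction of `k`, or `0` if `k = 0`. -/
def direction (k : Momentum) : EuclideanSpace ℝ (Fin 3) := (len k)⁻¹ • toE k

/-- The position of `p` relative to `k / 2`, the midpoint of the centers of `B_F` and `B_F + k`. -/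
def centered (k p : Momentum) : EuclideanSpace ℝ (Fin 3) := toE p - (1 / 2 : ℝ) • toE k

/-- The coordinate along `k` of the position of `p` relative to `k / 2`. -/
def height (k p : Momentum) : ℝ := ⟪direction k, centered k p⟫_ℝ

lemma norm_direction {k : Momentum} (hk : k ≠ 0) : ‖direction k‖ = 1 := by
  have hK := one_le_len hk
  rw [direction, norm_smul, norm_toE, norm_inv, Real.norm_of_nonneg (len_nonneg k),
    inv_mul_cancel₀ (by positivity)]

lemma toE_eq_len_smul_direction {k : Momentum} (hk : k ≠ 0) : toE k = len k • direction k := by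
  have hK := one_le_len hk
  rw [direction, smul_inv_smul₀ (by positivity)]

lemma luneGap_eq_height {k : Momentum} (hk : k ≠ 0) (p : Momentum) :
    (luneGap k p : ℝ) = 2 * len k * height k p := by
  have hK := one_le_len hk
  rw [luneGap_eq_inner, height, direction, centered, real_inner_smul_left, inner_sub_right,
    inner_smul_right, real_inner_self_eq_norm_sq, norm_toE, real_inner_comm]
  field_simp

lemma height_pos {kF : ℝ} {k p : Momentum} (hk : k ≠ 0) (hp : p ∈ lune kF k) :
    0 < height k p := by
  have hgap := one_le_luneGap hp
  rw [luneGap_eq_height hk] at hgap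
  exact pos_of_mul_pos_right (zero_lt_one.trans_le hgap)
    (mul_nonneg zero_le_two (len_nonneg k))

lemma height_le {kF : ℝ} {k p : Momentum} (hk : k ≠ 0) (hp : p ∈ lune kF k) :
    height k p ≤ kF + len k / 2 := by
  have hsplit : centered k p = toE (p - k) + (1 / 2 : ℝ) • toE k := by
    rw [centered, map_sub]
    module
  calc height k p ≤ ‖direction k‖ * ‖centered k p‖ := real_inner_le_norm _ _
    _ ≤ ‖toE (p - k)‖ + ‖(1 / 2 : ℝ) • toE k‖ := by
        rw [norm_direction hk, one_mul, hsplit]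
        exact norm_add_le _ _
    _ ≤ kF + len k / 2 := by
        rw [norm_smul, norm_toE, norm_toE, Real.norm_of_nonneg (by norm_num)]
        linarith [(mem_lune.1 hp).1]

lemma one_le_dist_centered (k : Momentum) {p q : Momentum} (h : p ≠ q) :
    1 ≤ dist (centered k p) (centered k q) := by
  rw [centered, centered, dist_sub_right]
  exact one_le_dist_toE h

lemma axisDist_centered_sq {k : Momentum} (hk : k ≠ 0) (p : Momentum) :
    axisDist (direction k) (centered k p) ^ 2 =
      len p ^ 2 - len k * height k p - len k ^ 2 / 4 - height k p ^ 2 := by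
  have hcentered : ‖centered k p‖ ^ 2 = len p ^ 2 - luneGap k p / 2 - len k ^ 2 / 4 := by
    rw [luneGap_eq_inner, centered, norm_sub_sq_real, norm_smul, inner_smul_right, norm_toE,
      norm_toE, Real.norm_of_nonneg (by norm_num)]
    ring
  rw [axisDist_sq (norm_direction hk), hcentered, luneGap_eq_height hk, height]
  ring

lemma centered_sub_zsmul {k : Momentum} (hk : k ≠ 0) (p : Momentum) (m : ℤ) :
    centered k (p - m • k) = centered k p - (m * len k) • direction k := by
  rw [centered, centered, map_sub, toE_zsmul, mul_smul, ← toE_eq_len_smul_direction hk,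
    sub_right_comm]

lemma height_sub_zsmul {k : Momentum} (hk : k ≠ 0) (p : Momentum) (m : ℤ) :
    height k (p - m • k) = height k p - m * len k := by
  rw [height, centered_sub_zsmul hk, inner_sub_right, inner_smul_right,
    real_inner_self_eq_norm_sq, norm_direction hk, one_pow, mul_one, height]

lemma height_sub_floor_mem {k : Momentum} (hk : k ≠ 0) (p : Momentum) :
    height k (p - ⌊height k p / len k⌋ • k) ∈ Set.Icc 0 (len k) := by
  have hK := one_le_len hk
  have hfloor := Int.floor_le (height k p / len k)
  have hfloor' := Int.lt_floor_add_one (height k p / len k)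
  rw [le_div_iff₀ (by positivity)] at hfloor
  rw [div_lt_iff₀ (by positivity)] at hfloor'
  rw [height_sub_zsmul hk]
  constructor <;> linarith

/-- The points of the lune whose height lies in `[t₀, t₁]`. -/
def luneSlab (kF : ℝ) (k : Momentum) (t₀ t₁ : ℝ) : Finset Momentum :=
  {p ∈ lune kF k | t₀ ≤ height k p ∧ height k p ≤ t₁}

lemma axisDist_mem_of_mem_luneSlab {kF : ℝ} (hkF : 0 ≤ kF) {k p : Momentum} (hk : k ≠ 0)
    {t₀ t₁ : ℝ} (ht₀ : 0 ≤ t₀) (hp : p ∈ luneSlab kF k t₀ t₁) :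
    axisDist (direction k) (centered k p) ∈
      Set.Icc √(kF ^ 2 - len k ^ 2 / 4 - len k * t₁ - t₁ ^ 2)
        √(kF ^ 2 - len k ^ 2 / 4 + len k * t₁ - t₀ ^ 2) := by
  obtain ⟨hlune, h₀, h₁⟩ := Finset.mem_filter.1 hp
  obtain ⟨hin, hout⟩ := mem_lune.1 hlune
  have hgap := luneGap_eq k p
  rw [luneGap_eq_height hk] at hgap
  have houtsq : kF ^ 2 ≤ len p ^ 2 := pow_le_pow_left₀ hkF hout.le 2
  have hinsq : len (p - k) ^ 2 ≤ kF ^ 2 := pow_le_pow_left₀ (len_nonneg _) hin 2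
  have hlow : t₀ ^ 2 ≤ height k p ^ 2 := pow_le_pow_left₀ ht₀ h₀ 2
  have hupp : height k p ^ 2 ≤ t₁ ^ 2 := pow_le_pow_left₀ (ht₀.trans h₀) h₁ 2
  have hmul : len k * height k p ≤ len k * t₁ := mul_le_mul_of_nonneg_left h₁ (len_nonneg k)
  constructor
  · rw [Real.sqrt_le_left (axisDist_nonneg _ _), axisDist_centered_sq hk]
    linarith
  · refine Real.le_sqrt_of_sq_le ?_
    rw [axisDist_centered_sq hk]
    linarith

lemma add_zsmul_notMem_lune {kF : ℝ} {k p : Momentum} (hp : p ∈ lune kF k) {m : ℤ} (hm : 0 < m) :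
    p + m • k ∉ lune kF k := by
  intro hq
  have hgap := one_le_luneGap hp
  rw [luneGap_eq_inner] at hgap
  have hinner : 0 ≤ ⟪toE p, toE k⟫_ℝ := by nlinarith [sq_nonneg (len k)]
  have hm' : (0 : ℝ) ≤ m - 1 := by
    rw [sub_nonneg]
    exact_mod_cast hm
  have hshift : toE (p + m • k - k) = toE p + (m - 1 : ℝ) • toE k := by
    rw [map_sub, map_add, toE_zsmul]
    module
  have hnorm : len p ^ 2 ≤ len (p + m • k - k) ^ 2 := by
    rw [← norm_toE, ← norm_toE, hshift, norm_add_sq_real, inner_smul_right]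
    have : 0 ≤ 2 * ((m - 1 : ℝ) * ⟪toE p, toE k⟫_ℝ) := by positivity
    linarith [sq_nonneg ‖(m - 1 : ℝ) • toE k‖]
  have hlen := (sq_le_sq₀ (len_nonneg _) (len_nonneg _)).1 hnorm
  linarith [(mem_lune.1 hp).2, (mem_lune.1 hq).1]

lemma eq_of_sub_zsmul_eq {kF : ℝ} {k p q : Momentum} (hp : p ∈ lune kF k) (hq : q ∈ lune kF k)
    {m n : ℤ} (h : p - m • k = q - n • k) : p = q := by
  have hpq : p = q + (m - n) • k := by rw [sub_smul, ← sub_eq_zero, ← sub_eq_zero.2 h]; abel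
  have hqp : q = p + (n - m) • k := by rw [sub_smul, ← sub_eq_zero, ← sub_eq_zero.2 h.symm]; abel
  rcases lt_trichotomy m n with hmn | rfl | hmn
  · exact absurd (hqp ▸ hq) (add_zsmul_notMem_lune hp (sub_pos.2 hmn))
  · rwa [sub_self, zero_smul, add_zero] at hpq
  · exact absurd (hpq ▸ hp) (add_zsmul_notMem_lune hq (sub_pos.2 hmn))

lemma sq_sqrt_sub_sq_sqrt_le {x y : ℝ} (h : x ≤ y) : √y ^ 2 - √x ^ 2 ≤ y - x := by
  rcases le_total 0 x with hx | hx
  · rw [Real.sq_sqrt hx, Real.sq_sqrt (hx.trans h)]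
  · rcases le_total 0 y with hy | hy
    · rw [Real.sq_sqrt hy, Real.sqrt_eq_zero_of_nonpos hx]
      linarith
    · rw [Real.sqrt_eq_zero_of_nonpos hy, Real.sqrt_eq_zero_of_nonpos hx]
      linarith

lemma card_le_of_mem_shell_sqrt {ι : Type*} {e : EuclideanSpace ℝ (Fin 3)} (he : ‖e‖ = 1)
    {t₁ t₂ s₁ s₂ r : ℝ} (ht : t₁ ≤ t₂) (hs : s₁ ≤ s₂) (hr : √s₂ ≤ r) {F : Finset ι}
    {f : ι → EuclideanSpace ℝ (Fin 3)}
    (hsep : (F : Set ι).Pairwise fun i j => 1 ≤ dist (f i) (f j))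
    (hF : ∀ i ∈ F, f i ∈ cylindricalShell e t₁ t₂ √s₁ √s₂) :
    (F.card : ℝ) ≤ 12 * (t₂ - t₁ + 1) * (s₂ - s₁ + r + 1) := by
  refine (card_le_of_mem_cylindricalShell he ht (Real.sqrt_nonneg _) (Real.sqrt_le_sqrt hs) hsep
    hF).trans (mul_le_mul_of_nonneg_left ?_ (by linarith))
  linarith [sq_sqrt_sub_sq_sqrt_le hs]

lemma card_luneSlab_le {kF : ℝ} (hkF : 0 ≤ kF) {k : Momentum} (hk : k ≠ 0) {t₀ t₁ : ℝ}
    (ht₀ : 0 ≤ t₀) (ht : t₀ ≤ t₁) :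
    ((luneSlab kF k t₀ t₁).card : ℝ) ≤ 12 * (min (t₁ - t₀) (len k) + 1) *
      (3 * len k * t₁ + t₁ ^ 2 - t₀ ^ 2 + kF + 2) := by
  have hKt : 0 ≤ len k * t₁ := mul_nonneg (len_nonneg k) (ht₀.trans ht)
  have hs : kF ^ 2 - len k ^ 2 / 4 - len k * t₁ - t₁ ^ 2 ≤
      kF ^ 2 - len k ^ 2 / 4 + len k * t₁ - t₀ ^ 2 := by nlinarith
  have hr : √(kF ^ 2 - len k ^ 2 / 4 + len k * t₁ - t₀ ^ 2) ≤ kF + len k * t₁ + 1 :=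
    Real.sqrt_le_iff.2 ⟨by positivity, by nlinarith⟩
  have hbound : kF ^ 2 - len k ^ 2 / 4 + len k * t₁ - t₀ ^ 2 -
      (kF ^ 2 - len k ^ 2 / 4 - len k * t₁ - t₁ ^ 2) + (kF + len k * t₁ + 1) + 1 =
      3 * len k * t₁ + t₁ ^ 2 - t₀ ^ 2 + kF + 2 := by ring
  rcases min_choice (t₁ - t₀) (len k) with hmin | hmin <;> rw [hmin, ← hbound]
  · refine card_le_of_mem_shell_sqrt (norm_direction hk) ht hs hr (f := centered k)
      (fun p _ q _ => one_le_dist_centered k) fun p hp => ?_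
    exact ⟨(Finset.mem_filter.1 hp).2, axisDist_mem_of_mem_luneSlab hkF hk ht₀ hp⟩
  · -- Distinct points of the lune never differ by a multiple of `k`, so shifting all heights into
    -- `[0, |k|]` keeps the points apart.
    refine (card_le_of_mem_shell_sqrt (norm_direction hk) (len_nonneg k) hs hr
      (f := fun p => centered k (p - ⌊height k p / len k⌋ • k)) (fun p hp q hq hpq => ?_)
      fun p hp => ⟨height_sub_floor_mem hk p, ?_⟩).trans_eq (by rw [sub_zero])
    · exact one_le_dist_centered k fun h => hpq
        (eq_of_sub_zsmul_eq (Finset.mem_filter.1 hp).1 (Finset.mem_filter.1 hq).1 h)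
    · rw [centered_sub_zsmul hk, axisDist_sub_smul]
      exact axisDist_mem_of_mem_luneSlab hkF hk ht₀ hp

lemma sum_inv_luneGap_le_of_four_mul_lt {kF : ℝ} (hkF : 0 ≤ kF) {k : Momentum} (hk : k ≠ 0)
    (hlarge : 4 * kF < len k) :
    ∑ p ∈ lune kF k, (luneGap k p : ℝ)⁻¹ ≤ 5 * (particleNumber kF : ℝ) ^ (1 / 3 : ℝ) := by
  have hK := one_le_len hk
  set ν := (particleNumber kF : ℝ) ^ (1 / 3 : ℝ) with hν
  have hν_le : ν ≤ 3 / 2 * len k := (rpow_third_particleNumber_le hkF).trans (by linarith)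
  have hcard : ((lune kF k).card : ℝ) ≤ ν ^ 3 := by
    rw [hν, rpow_third_pow_three (Nat.cast_nonneg _)]
    exact_mod_cast card_lune_le kF k
  have hterm : ∀ p ∈ lune kF k, (luneGap k p : ℝ)⁻¹ ≤ (len k ^ 2 / 2)⁻¹ := by
    intro p hp
    have htri : len k ≤ len p + len (p - k) := by simpa using len_sub_le p (p - k)
    rw [inv_le_inv₀ (by linarith [one_le_luneGap hp]) (by positivity), luneGap_eq]
    nlinarith [(mem_lune.1 hp).1, len_nonneg (p - k)]
  calc ∑ p ∈ lune kF k, (luneGap k p : ℝ)⁻¹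
      ≤ (lune kF k).card * (len k ^ 2 / 2)⁻¹ := by
        rw [← nsmul_eq_mul]
        exact Finset.sum_le_card_nsmul _ _ _ hterm
    _ ≤ ν ^ 3 * (len k ^ 2 / 2)⁻¹ := by gcongr
    _ ≤ 5 * ν := by
        rw [← div_eq_mul_inv, div_le_iff₀ (by positivity)]
        have hsq : ν ^ 2 ≤ (3 / 2 * len k) ^ 2 := by gcongr
        nlinarith [(by positivity : 0 ≤ ν)]

lemma sum_inv_luneGap_luneSlab_zero_le {kF : ℝ} (hkF : 0 ≤ kF) {k : Momentum} (hk : k ≠ 0)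
    (hsmall : len k ≤ 4 * kF) :
    ∑ p ∈ luneSlab kF k 0 1, (luneGap k p : ℝ)⁻¹ ≤ 312 * (kF + 1) := by
  calc ∑ p ∈ luneSlab kF k 0 1, (luneGap k p : ℝ)⁻¹ ≤ ∑ _p ∈ luneSlab kF k 0 1, (1 : ℝ) :=
        Finset.sum_le_sum fun p hp => inv_le_one_of_one_le₀
          (one_le_luneGap (Finset.mem_filter.1 hp).1)
    _ = (luneSlab kF k 0 1).card := by rw [Finset.sum_const, nsmul_one]
    _ ≤ 12 * (min (1 - 0) (len k) + 1) * (3 * len k * 1 + 1 ^ 2 - 0 ^ 2 + kF + 2) :=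
        card_luneSlab_le hkF hk le_rfl zero_le_one
    _ ≤ 12 * (1 + 1) * (13 * kF + 3) := by
        have hmin : min (1 - 0) (len k) ≤ 1 := (min_le_left _ _).trans_eq (sub_zero 1)
        refine mul_le_mul ?_ ?_ ?_ ?_ <;> linarith [len_nonneg k]
    _ ≤ 312 * (kF + 1) := by linarith

lemma card_luneSlab_sq_le {kF : ℝ} (hkF : 0 ≤ kF) {k : Momentum} (hk : k ≠ 0) {x : ℝ}
    (hx : 1 ≤ x) :
    ((luneSlab kF k (x ^ 2) ((x + 1) ^ 2)).card : ℝ) ≤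
      12 * (4 * x) * (12 * len k * x ^ 2) + 12 * (2 * len k) * (15 * x ^ 3 + 2 * (kF + 1)) := by
  have hK := one_le_len hk
  have hwidth : min ((x + 1) ^ 2 - x ^ 2) (len k) + 1 ≤ min (4 * x) (2 * len k) :=
    le_min (by linarith [min_le_left ((x + 1) ^ 2 - x ^ 2) (len k)])
      (by linarith [min_le_right ((x + 1) ^ 2 - x ^ 2) (len k)])
  have hdepth : 3 * len k * (x + 1) ^ 2 + ((x + 1) ^ 2) ^ 2 - (x ^ 2) ^ 2 + kF + 2 ≤
      12 * len k * x ^ 2 + (15 * x ^ 3 + 2 * (kF + 1)) := by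
    have hsq : (x + 1) ^ 2 ≤ 4 * x ^ 2 := by nlinarith
    have hcube : ((x + 1) ^ 2) ^ 2 - (x ^ 2) ^ 2 ≤ 15 * x ^ 3 := by
      nlinarith [pow_le_pow_right₀ hx (show 2 ≤ 3 by norm_num),
        pow_le_pow_right₀ hx (show 1 ≤ 3 by norm_num), one_le_pow₀ hx (n := 3)]
    nlinarith
  calc ((luneSlab kF k (x ^ 2) ((x + 1) ^ 2)).card : ℝ)
      ≤ 12 * (min ((x + 1) ^ 2 - x ^ 2) (len k) + 1) *
        (3 * len k * (x + 1) ^ 2 + ((x + 1) ^ 2) ^ 2 - (x ^ 2) ^ 2 + kF + 2) :=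
        card_luneSlab_le hkF hk (by positivity) (by gcongr; linarith)
    _ ≤ 12 * min (4 * x) (2 * len k) *
        (12 * len k * x ^ 2 + (15 * x ^ 3 + 2 * (kF + 1))) := by
        have hsub : 0 ≤ ((x + 1) ^ 2) ^ 2 - (x ^ 2) ^ 2 := sub_nonneg.2 (by gcongr; linarith)
        refine mul_le_mul (by gcongr) hdepth ?_ (by positivity)
        linarith [(by positivity : 0 ≤ 3 * len k * (x + 1) ^ 2)]
    _ ≤ _ := by
        rw [mul_add]
        gcongr
        exacts [min_le_left _ _, min_le_right _ _]

lemma sum_inv_luneGap_luneSlab_sq_le {kF : ℝ} (hkF : 0 ≤ kF) {k : Momentum} (hk : k ≠ 0) {x : ℝ}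
    (hx : 1 ≤ x) :
    ∑ p ∈ luneSlab kF k (x ^ 2) ((x + 1) ^ 2), (luneGap k p : ℝ)⁻¹ ≤
      468 * x + 24 * (kF + 1) * (x ^ 2)⁻¹ := by
  have hK := one_le_len hk
  have hterm : ∀ p ∈ luneSlab kF k (x ^ 2) ((x + 1) ^ 2),
      (luneGap k p : ℝ)⁻¹ ≤ (2 * len k * x ^ 2)⁻¹ := by
    intro p hp
    rw [luneGap_eq_height hk]
    gcongr
    exact (Finset.mem_filter.1 hp).2.1
  calc ∑ p ∈ luneSlab kF k (x ^ 2) ((x + 1) ^ 2), (luneGap k p : ℝ)⁻¹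
      ≤ (luneSlab kF k (x ^ 2) ((x + 1) ^ 2)).card * (2 * len k * x ^ 2)⁻¹ := by
        rw [← nsmul_eq_mul]
        exact Finset.sum_le_card_nsmul _ _ _ hterm
    _ ≤ (12 * (4 * x) * (12 * len k * x ^ 2) + 12 * (2 * len k) * (15 * x ^ 3 + 2 * (kF + 1))) *
        (2 * len k * x ^ 2)⁻¹ := by
        gcongr
        exact card_luneSlab_sq_le hkF hk hx
    _ = 468 * x + 24 * (kF + 1) * (x ^ 2)⁻¹ := by
        field_simp
        ring

lemma mem_luneSlab_floor_sqrt_height {kF : ℝ} {k p : Momentum} (hk : k ≠ 0) (hp : p ∈ lune kF k) :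
    p ∈ luneSlab kF k ((⌊√(height k p)⌋₊ : ℝ) ^ 2) ((⌊√(height k p)⌋₊ + 1 : ℝ) ^ 2) := by
  refine Finset.mem_filter.2 ⟨hp, ?_, ?_⟩
  · exact (Real.le_sqrt (Nat.cast_nonneg _) (height_pos hk hp).le).1
      (Nat.floor_le (Real.sqrt_nonneg _))
  · exact (Real.sqrt_le_left (by positivity)).1 (Nat.lt_floor_add_one _).le

lemma sum_inv_luneGap_le_sum_luneSlab {kF : ℝ} {k : Momentum} (hk : k ≠ 0)
    (hsmall : len k ≤ 4 * kF) :
    ∑ p ∈ lune kF k, (luneGap k p : ℝ)⁻¹ ≤ ∑ j ∈ Finset.Icc 0 ⌊√(3 * kF)⌋₊,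
      ∑ p ∈ luneSlab kF k ((j : ℝ) ^ 2) ((j + 1 : ℝ) ^ 2), (luneGap k p : ℝ)⁻¹ := by
  have hmaps : ∀ p ∈ lune kF k, ⌊√(height k p)⌋₊ ∈ Finset.Icc 0 ⌊√(3 * kF)⌋₊ := fun p hp =>
    Finset.mem_Icc.2 ⟨Nat.zero_le _, Nat.floor_le_floor (Real.sqrt_le_sqrt
      ((height_le hk hp).trans (by linarith)))⟩
  rw [← Finset.sum_fiberwise_of_maps_to hmaps]
  refine Finset.sum_le_sum fun j _ => Finset.sum_le_sum_of_subset_of_nonneg (fun p hp => ?_)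
    fun p hp _ => inv_nonneg.2 (zero_le_one.trans (one_le_luneGap (Finset.mem_filter.1 hp).1))
  obtain ⟨hlune, rfl⟩ := Finset.mem_filter.1 hp
  exact mem_luneSlab_floor_sqrt_height hk hlune

lemma sum_inv_luneGap_le {kF : ℝ} (hkF : 0 ≤ kF) {k : Momentum} (hk : k ≠ 0) :
    ∑ p ∈ lune kF k, (luneGap k p : ℝ)⁻¹ ≤ 5292 * (particleNumber kF : ℝ) ^ (1 / 3 : ℝ) := by
  rcases lt_or_ge (4 * kF) (len k) with hlarge | hsmall
  · refine (sum_inv_luneGap_le_of_four_mul_lt hkF hk hlarge).trans ?_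
    gcongr
    norm_num
  set J := ⌊√(3 * kF)⌋₊
  have hJ : (J : ℝ) ^ 2 ≤ 3 * kF :=
    (Real.le_sqrt (Nat.cast_nonneg _) (by positivity)).1 (Nat.floor_le (Real.sqrt_nonneg _))
  have hlinear : ∑ j ∈ Finset.Ioc 0 J, (j : ℝ) ≤ 3 * kF := by
    refine (Finset.sum_le_card_nsmul _ _ (J : ℝ) fun j hj => ?_).trans ?_
    · exact_mod_cast (Finset.mem_Ioc.1 hj).2
    · rwa [Nat.card_Ioc, tsub_zero, nsmul_eq_mul, ← sq]
  have hinv : ∑ j ∈ Finset.Ioc 0 J, ((j : ℝ) ^ 2)⁻¹ ≤ 2 := by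
    have hsum := sum_Ioo_inv_sq_le (α := ℝ) 0 (J + 1)
    rwa [Nat.cast_zero, zero_add, div_one] at hsum
  calc ∑ p ∈ lune kF k, (luneGap k p : ℝ)⁻¹
      ≤ ∑ j ∈ Finset.Icc 0 J,
          ∑ p ∈ luneSlab kF k ((j : ℝ) ^ 2) ((j + 1 : ℝ) ^ 2), (luneGap k p : ℝ)⁻¹ :=
        sum_inv_luneGap_le_sum_luneSlab hk hsmall
    _ ≤ 312 * (kF + 1) +
          ∑ j ∈ Finset.Ioc 0 J, (468 * (j : ℝ) + 24 * (kF + 1) * ((j : ℝ) ^ 2)⁻¹) := by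
        rw [← Finset.Ioc_insert_left J.zero_le, Finset.sum_insert Finset.left_notMem_Ioc]
        refine add_le_add ?_ (Finset.sum_le_sum fun j hj => ?_)
        · simpa using sum_inv_luneGap_luneSlab_zero_le hkF hk hsmall
        · exact sum_inv_luneGap_luneSlab_sq_le hkF hk (by exact_mod_cast (Finset.mem_Ioc.1 hj).1)
    _ ≤ 312 * (kF + 1) + (468 * (3 * kF) + 24 * (kF + 1) * 2) := by
        rw [Finset.sum_add_distrib, ← Finset.mul_sum, ← Finset.mul_sum]
        gcongr
    _ ≤ 5292 * (particleNumber kF : ℝ) ^ (1 / 3 : ℝ) := by linarith [kF_add_one_le hkF]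

/-! ### Pair operators and the kinetic energy -/

lemma norm_annihilate_le (p : Momentum) (ξ : Fock) : ‖annihilate p ξ‖ ≤ ‖ξ‖ := by
  rw [← sq_le_sq₀ (norm_nonneg _) (norm_nonneg _), norm_sq_fock, norm_sq_fock]
  exact tsum_annihilateFun_le p ξ

lemma norm_annihilate_annihilate_comm (p q : Momentum) (ξ : Fock) :
    ‖annihilate p (annihilate q ξ)‖ = ‖annihilate q (annihilate p ξ)‖ := by
  rw [eq_neg_of_add_eq_zero_left (annihilate_annihilate p q ξ), norm_neg]

lemma hbar_pos {kF : ℝ} (h : 0 ≤ kF) : 0 < hbar kF :=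
  Real.rpow_pos_of_pos (one_pos.trans_le (one_le_particleNumber h)) _

lemma hbar_sq_mul_particleNumber {kF : ℝ} (h : 0 ≤ kF) :
    hbar kF ^ 2 * (particleNumber kF : ℝ) = (particleNumber kF : ℝ) ^ (1 / 3 : ℝ) := by
  have hN : (0 : ℝ) < particleNumber kF := one_pos.trans_le (one_le_particleNumber h)
  rw [hbar, ← Real.rpow_natCast, ← Real.rpow_mul hN.le, ← Real.rpow_add_one hN.ne']
  norm_num

lemma excitationEnergy_eq (kF : ℝ) (p : Momentum) :
    excitationEnergy kF p = hbar kF ^ 2 * |len p ^ 2 - kF ^ 2| := by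
  have hkappa : kappa kF = hbar kF * kF := by
    rw [kappa, hbar, Real.rpow_neg (Nat.cast_nonneg _), div_eq_inv_mul]
  rw [excitationEnergy, hkappa, mul_pow, ← mul_sub, abs_mul, abs_of_nonneg (sq_nonneg (hbar kF))]

lemma excitationEnergy_nonneg (kF : ℝ) (p : Momentum) : 0 ≤ excitationEnergy kF p := abs_nonneg _

lemma excitationEnergy_mul_nonneg (kF : ℝ) (ξ : Fock) (p : Momentum) :
    0 ≤ excitationEnergy kF p * ‖annihilate p ξ‖ ^ 2 :=
  mul_nonneg (excitationEnergy_nonneg kF p) (sq_nonneg _)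

lemma kineticForm_nonneg (kF : ℝ) (ξ : Fock) : 0 ≤ kineticForm kF ξ :=
  tsum_nonneg (excitationEnergy_mul_nonneg kF ξ)

lemma excitationEnergy_add_of_mem_lune {kF : ℝ} {k p : Momentum} (hp : p ∈ lune kF k) :
    excitationEnergy kF p + excitationEnergy kF (p - k) = hbar kF ^ 2 * luneGap k p := by
  obtain ⟨hhole, hparticle⟩ := mem_lune.1 hp
  have hnonneg := len_nonneg (p - k)
  rw [excitationEnergy_eq, excitationEnergy_eq, luneGap_eq, abs_of_nonneg (by nlinarith),
    abs_of_nonpos (by nlinarith)]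
  ring

lemma sum_le_kineticForm {kF : ℝ} {ξ : Fock} (hξ : ξ ∈ kineticDomain kF) (s : Finset Momentum) :
    ∑ p ∈ s, excitationEnergy kF p * ‖annihilate p ξ‖ ^ 2 ≤ kineticForm kF ξ :=
  Summable.sum_le_tsum s (fun p _ => excitationEnergy_mul_nonneg kF ξ p) hξ

lemma sum_luneGap_mul_norm_sq_le {kF : ℝ} (k : Momentum) {ξ : Fock} (hξ : ξ ∈ kineticDomain kF) :
    ∑ p ∈ lune kF k, hbar kF ^ 2 * luneGap k p * ‖annihilate (p - k) (annihilate p ξ)‖ ^ 2 ≤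
      2 * kineticForm kF ξ := by
  calc _ ≤ ∑ p ∈ lune kF k, (excitationEnergy kF p * ‖annihilate p ξ‖ ^ 2 +
          excitationEnergy kF (p - k) * ‖annihilate (p - k) ξ‖ ^ 2) := by
        refine Finset.sum_le_sum fun p hp => ?_
        rw [← excitationEnergy_add_of_mem_lune hp, add_mul]
        gcongr
        · exact excitationEnergy_nonneg kF p
        · exact norm_annihilate_le _ _
        · exact excitationEnergy_nonneg kF (p - k)
        · rw [norm_annihilate_annihilate_comm]
          exact norm_annihilate_le _ _
    _ = ∑ p ∈ lune kF k, excitationEnergy kF p * ‖annihilate p ξ‖ ^ 2 +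
          ∑ p ∈ (lune kF k).image (· - k), excitationEnergy kF p * ‖annihilate p ξ‖ ^ 2 := by
        rw [Finset.sum_add_distrib, Finset.sum_image sub_left_injective.injOn]
    _ ≤ 2 * kineticForm kF ξ := by
        rw [two_mul]
        exact add_le_add (sum_le_kineticForm hξ _) (sum_le_kineticForm hξ _)

lemma lune_zero (kF : ℝ) : lune kF 0 = ∅ := by
  refine Finset.eq_empty_of_forall_notMem fun p hp => ?_
  rw [mem_lune, sub_zero] at hp
  exact hp.2.not_ge hp.1

lemma sum_inv_hbar_sq_mul_luneGap_le {kF : ℝ} (hkF : 0 ≤ kF) (k : Momentum) :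
    ∑ p ∈ lune kF k, (hbar kF ^ 2 * luneGap k p : ℝ)⁻¹ ≤ 5292 * particleNumber kF := by
  rcases eq_or_ne k 0 with rfl | hk
  · rw [lune_zero, Finset.sum_empty]
    positivity
  have hpos := pow_pos (hbar_pos hkF) 2
  simp_rw [mul_inv]
  rw [← Finset.mul_sum, inv_mul_le_iff₀ hpos]
  linarith [sum_inv_luneGap_le hkF hk, hbar_sq_mul_particleNumber hkF]

/-- Cauchy–Schwarz with the weights `e(p) + e(p - k)`, which are the energies of the pairs. -/
lemma norm_pairOp_sq_le {kF : ℝ} (hkF : 0 ≤ kF) (k : Momentum) {ξ : Fock}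
    (hξ : ξ ∈ kineticDomain kF) :
    ‖pairOp kF k ξ‖ ^ 2 ≤ 10584 * particleNumber kF * kineticForm kF ξ := by
  set v : Momentum → Fock := fun p => annihilate (p - k) (annihilate p ξ)
  set w : Momentum → ℝ := fun p => hbar kF ^ 2 * luneGap k p
  have hw (p) (hp : p ∈ lune kF k) : 0 < w p :=
    mul_pos (pow_pos (hbar_pos hkF) 2) (by linarith [one_le_luneGap hp])
  have hnorm : ‖pairOp kF k ξ‖ ≤ ∑ p ∈ lune kF k, ‖v p‖ := by
    have hsum : pairOp kF k ξ = ∑ p ∈ lune kF k, v p := by simp [pairOp, v]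
    exact hsum ▸ norm_sum_le _ _
  have hcauchy : (∑ p ∈ lune kF k, ‖v p‖) ^ 2 ≤
      (∑ p ∈ lune kF k, (w p)⁻¹) * ∑ p ∈ lune kF k, w p * ‖v p‖ ^ 2 := by
    refine Finset.sum_sq_le_sum_mul_sum_of_sq_le_mul _ (fun p hp => (inv_pos.2 (hw p hp)).le)
      (fun p hp => mul_nonneg (hw p hp).le (sq_nonneg _)) fun p hp => ?_
    exact (inv_mul_cancel_left₀ (hw p hp).ne' _).ge
  calc ‖pairOp kF k ξ‖ ^ 2 ≤ (∑ p ∈ lune kF k, ‖v p‖) ^ 2 := by gcongr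
    _ ≤ (∑ p ∈ lune kF k, (w p)⁻¹) * ∑ p ∈ lune kF k, w p * ‖v p‖ ^ 2 := hcauchy
    _ ≤ 5292 * particleNumber kF * (2 * kineticForm kF ξ) := by
        refine mul_le_mul (sum_inv_hbar_sq_mul_luneGap_le hkF k) (sum_luneGap_mul_norm_sq_le k hξ)
          ?_ (by positivity)
        exact Finset.sum_nonneg fun p hp => mul_nonneg (hw p hp).le (sq_nonneg _)
    _ = 10584 * particleNumber kF * kineticForm kF ξ := by ring

lemma abs_couplingForm_le {s : ℝ} (hs : 0 < s) (kF : ℝ) (k : Momentum) (ξ : Fock) :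
    |couplingForm kF k ξ| ≤ s * ‖nonBosonizable kF k ξ‖ ^ 2 + s⁻¹ * ‖pairOp kF (-k) ξ‖ ^ 2 := by
  set x := ‖nonBosonizable kF k ξ‖
  set y := ‖pairOp kF (-k) ξ‖
  have hyoung : s * x ^ 2 + s⁻¹ * y ^ 2 - 2 * (x * y) = s * (x - s⁻¹ * y) ^ 2 := by
    field_simp
    ring
  calc |couplingForm kF k ξ| ≤ 2 * (x * y) := by
        rw [couplingForm, abs_mul, abs_two]
        gcongr
        exact (Complex.abs_re_le_norm _).trans (norm_inner_le_norm _ _)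
    _ ≤ s * x ^ 2 + s⁻¹ * y ^ 2 := by linarith [mul_nonneg hs.le (sq_nonneg (x - s⁻¹ * y))]

lemma abs_E2Form_le {V : Momentum → ℝ} (hV : Summable V) (hV0 : ∀ k, 0 ≤ V k) {kF : ℝ}
    (hkF : 0 ≤ kF) {s : ℝ} (hs : 0 < s) {ξ : Fock} (hE1 : ξ ∈ E1Domain V kF)
    (hξ : ξ ∈ kineticDomain kF) :
    Summable (fun k => V k * couplingForm kF k ξ) ∧
      |E2Form V kF ξ| ≤ s * E1Form V kF ξ + 5292 * (∑' k, V k) * s⁻¹ * kineticForm kF ξ := by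
  have hN : (0 : ℝ) < particleNumber kF := one_pos.trans_le (one_le_particleNumber hkF)
  set D : ℝ := 10584 * particleNumber kF * kineticForm kF ξ with hD
  set g : Momentum → ℝ := fun k => s * (V k * ‖nonBosonizable kF k ξ‖ ^ 2) + s⁻¹ * D * V k
  have hg : HasSum g (s * ∑' k, V k * ‖nonBosonizable kF k ξ‖ ^ 2 + s⁻¹ * D * ∑' k, V k) :=
    (hE1.2.hasSum.mul_left s).add (hV.hasSum.mul_left _)
  have hle (k) : ‖V k * couplingForm kF k ξ‖ ≤ g k := by
    calc ‖V k * couplingForm kF k ξ‖ = V k * |couplingForm kF k ξ| := by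
          rw [norm_mul, Real.norm_of_nonneg (hV0 k), Real.norm_eq_abs]
      _ ≤ V k * (s * ‖nonBosonizable kF k ξ‖ ^ 2 + s⁻¹ * D) := by
          refine mul_le_mul_of_nonneg_left ((abs_couplingForm_le hs kF k ξ).trans ?_) (hV0 k)
          gcongr
          exact norm_pairOp_sq_le hkF (-k) hξ
      _ = g k := by ring
  refine ⟨.of_norm_bounded hg.summable hle, ?_⟩
  calc |E2Form V kF ξ| ≤ 1 / (2 * particleNumber kF) *
          (s * (∑' k, V k * ‖nonBosonizable kF k ξ‖ ^ 2) + s⁻¹ * D * ∑' k, V k) := by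
        rw [E2Form, abs_mul, abs_of_nonneg (by positivity)]
        gcongr
        exact tsum_of_norm_bounded hg hle
    _ = s * E1Form V kF ξ + 5292 * (∑' k, V k) * s⁻¹ * kineticForm kF ξ := by
        rw [E1Form, hD]
        field_simp
        ring

/-! ### Representations of integers by binary quadratic forms -/

/-- The binary quadratic form `a x² + b x y + c y²`. -/
structure BinaryForm where
  a : ℤ
  b : ℤ
  c : ℤ

namespace BinaryForm

instance : CoeFun BinaryForm fun _ => ℤ × ℤ → ℤ :=
  ⟨fun Q v => Q.a * v.1 ^ 2 + Q.b * v.1 * v.2 + Q.c * v.2 ^ 2⟩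

/-- Positive definiteness, in terms of the leading coefficient and the discriminant. -/
def PosDef (Q : BinaryForm) : Prop := 0 < Q.a ∧ Q.b ^ 2 < 4 * Q.a * Q.c

lemma PosDef.pos {Q : BinaryForm} (hQ : Q.PosDef) {v : ℤ × ℤ} (hv : v ≠ 0) : 0 < Q v := by
  obtain ⟨ha, hdisc⟩ := hQ
  have hsquare : 4 * Q.a * Q v =
      (2 * Q.a * v.1 + Q.b * v.2) ^ 2 + (4 * Q.a * Q.c - Q.b ^ 2) * v.2 ^ 2 := by ring
  refine pos_of_mul_pos_right (a := 4 * Q.a) ?_ (by positivity)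
  rw [hsquare]
  rw [← sub_pos] at hdisc
  by_cases h : v.2 = 0
  · have hv1 : v.1 ≠ 0 := fun h1 => hv (Prod.ext h1 h)
    rw [h]
    simp only [mul_zero, add_zero, ne_eq, OfNat.ofNat_ne_zero, not_false_eq_true, zero_pow]
    positivity
  · positivity

lemma PosDef.nonneg {Q : BinaryForm} (hQ : Q.PosDef) (v : ℤ × ℤ) : 0 ≤ Q v := by
  rcases eq_or_ne v 0 with rfl | hv
  · simp
  · exact (hQ.pos hv).le

lemma PosDef.eq_zero {Q : BinaryForm} (hQ : Q.PosDef) {v : ℤ × ℤ} (hv : Q v = 0) : v = 0 :=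
  not_imp_comm.1 hQ.pos hv.le.not_gt

/-- The form `Q(y, x)`. -/
def swap (Q : BinaryForm) : BinaryForm := ⟨Q.c, Q.b, Q.a⟩

lemma swap_apply (Q : BinaryForm) (v : ℤ × ℤ) : Q.swap v = Q v.swap := by
  simp only [swap, Prod.fst_swap, Prod.snd_swap]
  ring

lemma PosDef.swap {Q : BinaryForm} (hQ : Q.PosDef) : Q.swap.PosDef := by
  refine ⟨?_, ?_⟩
  · simpa [BinaryForm.swap] using hQ.pos (v := (0, 1)) (by simp)
  · simp only [BinaryForm.swap]
    linarith [hQ.2]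

/-- The form `Q(x, y + t x)`. -/
def shear (Q : BinaryForm) (t : ℤ) : BinaryForm := ⟨Q (1, t), Q.b + 2 * Q.c * t, Q.c⟩

lemma shear_apply (Q : BinaryForm) (t : ℤ) (v : ℤ × ℤ) :
    Q.shear t v = Q (v.1, v.2 + t * v.1) := by
  simp only [shear]
  ring

lemma PosDef.shear {Q : BinaryForm} (hQ : Q.PosDef) (t : ℤ) : (Q.shear t).PosDef := by
  refine ⟨hQ.pos (by simp), ?_⟩
  simp only [BinaryForm.shear]
  linarith [hQ.2]

/-- The form `Q(x, p y) / p`, which is integral if `p` divides the leading coefficient. -/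
def descend (Q : BinaryForm) (p : ℤ) : BinaryForm := ⟨Q.a / p, Q.b, p * Q.c⟩

lemma mul_descend_apply {Q : BinaryForm} {p : ℤ} (hp : p ∣ Q.a) (v : ℤ × ℤ) :
    p * Q.descend p v = Q (v.1, p * v.2) := by
  simp only [descend]
  linear_combination v.1 ^ 2 * Int.mul_ediv_cancel' hp

lemma PosDef.descend {Q : BinaryForm} (hQ : Q.PosDef) {p : ℤ} (hp : 0 < p) (hpa : p ∣ Q.a) :
    (Q.descend p).PosDef := by
  refine ⟨Int.ediv_pos_of_pos_of_dvd hQ.1 hp.le hpa, ?_⟩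
  simp only [BinaryForm.descend]
  linear_combination hQ.2 - 4 * Q.c * Int.mul_ediv_cancel' hpa

/-- The vectors on which `Q` takes the value `m`. -/
def reps (Q : BinaryForm) (m : ℤ) : Set (ℤ × ℤ) := {v | Q v = m}

/-- The representations of `m` by vectors that are not divisible by `p`. -/
def primitiveReps (Q : BinaryForm) (p m : ℤ) : Set (ℤ × ℤ) :=
  {v | Q v = m ∧ ¬ (p ∣ v.1 ∧ p ∣ v.2)}

/-- The representations of `m` by vectors whose first entry is not divisible by `p`. If
`Q ≡ x (a x + b y)` modulo `p`, these lie over the line `a x + b y = 0`. -/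
def splitReps (Q : BinaryForm) (p m : ℤ) : Set (ℤ × ℤ) := {v | Q v = m ∧ ¬ p ∣ v.1}

/-- Every positive definite form represents `m` at most `B` times. -/
def RepBound (B : ℕ∞) (m : ℤ) : Prop := ∀ Q : BinaryForm, Q.PosDef → (Q.reps m).encard ≤ B

lemma encard_le_of_subset_image {α β : Type*} {s : Set α} {t : Set β} (f : β → α)
    (h : s ⊆ f '' t) : s.encard ≤ t.encard :=
  (Set.encard_le_encard h).trans (Set.encard_image_le f t)

/-- The parallelogram identity `Q(s) + Q(v + s) = 1`, where `w = v + 2 s`, forces one of the two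
values to vanish. -/
lemma PosDef.eq_or_eq_neg_of_apply_eq_one {Q : BinaryForm} (hQ : Q.PosDef) {v s : ℤ × ℤ}
    (hv : Q v = 1) (hw : Q (v + 2 • s) = 1) : v + 2 • s = v ∨ v + 2 • s = -v := by
  have hsum : Q s + Q (v + s) = 1 := by
    simp only [Prod.fst_add, Prod.snd_add, two_nsmul] at hv hw ⊢
    linarith
  have hcase : Q s = 0 ∨ Q (v + s) = 0 := by
    have := hQ.nonneg s
    have := hQ.nonneg (v + s)
    lia
  rcases hcase with h | h
  · left
    rw [hQ.eq_zero h, smul_zero, add_zero]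
  · right
    rw [eq_neg_of_add_eq_zero_right (hQ.eq_zero h), smul_neg, two_nsmul]
    abel

lemma repBound_one : RepBound 8 1 := by
  intro Q hQ
  have hne {v} (hv : v ∈ Q.reps 1) : v ≠ 0 := by
    rintro rfl
    simp [reps] at hv
  -- A class modulo `2` contains at most one pair `±v`; the order tells `v` from `-v`.
  let φ : ℤ × ℤ → ZMod 2 × ZMod 2 × Bool := fun v => (v.1, v.2, decide (0 < toLex v))
  have hinj : Set.InjOn φ (Q.reps 1) := by
    intro v hv w hw hvw
    simp only [φ, Prod.mk.injEq, decide_eq_decide] at hvw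
    obtain ⟨hfst, hsnd, hsign⟩ := hvw
    obtain ⟨s₁, hs₁⟩ := (ZMod.intCast_eq_intCast_iff_dvd_sub _ _ 2).1 hfst
    obtain ⟨s₂, hs₂⟩ := (ZMod.intCast_eq_intCast_iff_dvd_sub _ _ 2).1 hsnd
    obtain rfl : w = v + 2 • (s₁, s₂) := by
      ext <;> simp <;> push_cast at hs₁ hs₂ <;> lia
    rcases hQ.eq_or_eq_neg_of_apply_eq_one hv hw with h | h
    · exact h.symm
    · rw [h, toLex_neg, Left.neg_pos_iff] at hsign
      rcases lt_trichotomy (toLex v) 0 with hlt | heq | hgt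
      · exact absurd (hsign.2 hlt) hlt.not_gt
      · exact absurd (toLex_eq_zero.1 heq) (hne hv)
      · exact absurd (hsign.1 hgt) hgt.not_gt
  calc (Q.reps 1).encard ≤ (Set.univ : Set (ZMod 2 × ZMod 2 × Bool)).encard :=
        Set.encard_le_encard_of_injOn (Set.mapsTo_univ _ _) hinj
    _ = 8 := by
        rw [Set.encard_univ, ENat.card_eq_coe_fintype_card]
        rfl

lemma exists_dvd_add_mul {p b : ℤ} (hp : Prime p) (hb : ¬ p ∣ b) (a : ℤ) : ∃ t, p ∣ a + b * t := by
  obtain ⟨u, w, huw⟩ := hp.irreducible.coprime_iff_not_dvd.2 hb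
  exact ⟨-a * w, a * u, by linear_combination -a * huw⟩

section PrimePower

variable {Q : BinaryForm} {p : ℤ} {B : ℕ∞} {M : ℤ}

lemma exists_descend_apply_eq (hp : p ≠ 0) (ha : p ∣ Q.a) {v : ℤ × ℤ} {n : ℕ}
    (hv : Q v = p ^ (n + 1) * M) (hv2 : p ∣ v.2) :
    ∃ w : ℤ × ℤ, Q.descend p w = p ^ n * M ∧ (w.1, p * w.2) = v := by
  obtain ⟨x, y, rfl⟩ := hv2.elim fun y hy => (⟨v.1, y, Prod.ext rfl hy⟩ : ∃ x y, v = (x, p * y))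
  refine ⟨(x, y), mul_left_cancel₀ hp ?_, rfl⟩
  rw [mul_descend_apply ha, hv, pow_succ', mul_assoc]

/-- If `p ∣ Q.c` and `p ∤ Q.b`, then modulo `p` these representations lie on one line `y = t x`.
Shearing this line to `y = 0` and descending removes a factor `p`. -/
lemma encard_splitReps_le (hp : Prime p) (hpos : 0 < p) (hB : RepBound B M) (n : ℕ)
    (hQ : Q.PosDef) (hc : p ∣ Q.c) (hb : ¬ p ∣ Q.b) : (Q.splitReps p (p ^ n * M)).encard ≤ B := by
  induction n generalizing Q with
  | zero =>
    rw [pow_zero, one_mul]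
    exact (Set.encard_le_encard fun v hv => hv.1).trans (hB Q hQ)
  | succ n ih =>
    obtain ⟨t, ht⟩ := exists_dvd_add_mul hp hb Q.a
    have hta : p ∣ (Q.shear t).a := by
      simp only [shear, mul_one, one_pow]
      exact dvd_add ht (hc.mul_right _)
    have htb : ¬ p ∣ (Q.shear t).b := by
      simpa only [shear, dvd_add_left ((hc.mul_left 2).mul_right t)] using hb
    refine (encard_le_of_subset_image (fun w => (w.1, p * w.2 + t * w.1)) ?_).trans
      (ih ((hQ.shear t).descend hpos hta) (dvd_mul_right p _) htb)
    rintro ⟨x, y⟩ ⟨hv, hx⟩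
    have hdvd : p ∣ p ^ (n + 1) * M := (dvd_pow_self p n.succ_ne_zero).mul_right M
    have hlinear : p ∣ Q.a * x + Q.b * y := by
      refine (hp.dvd_or_dvd (a := x) ?_).resolve_left hx
      convert dvd_sub hdvd (hc.mul_right (y ^ 2)) using 1
      linear_combination hv
    have hline : p ∣ y - t * x := by
      refine (hp.dvd_or_dvd (a := Q.b) ?_).resolve_left hb
      convert dvd_sub hlinear (ht.mul_right x) using 1
      ring
    have hshear : Q.shear t (x, y - t * x) = p ^ (n + 1) * M := by
      rw [shear_apply, ← hv, sub_add_cancel]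
    obtain ⟨w, hw, hwv⟩ := exists_descend_apply_eq hp.ne_zero hta hshear hline
    obtain ⟨rfl, hy⟩ := Prod.mk.inj hwv
    exact ⟨w, ⟨hw, hx⟩, Prod.ext rfl (by linarith)⟩

/-- If `p ∣ Q.a` and `p ∤ Q.b`, then `Q` vanishes modulo `p` on two lines, one of them `y = 0`. -/
lemma encard_primitiveReps_le_of_not_dvd_b (hp : Prime p) (hpos : 0 < p) (hB : RepBound B M) (n : ℕ)
    (hQ : Q.PosDef) (ha : p ∣ Q.a) (hb : ¬ p ∣ Q.b) :
    (Q.primitiveReps p (p ^ (n + 1) * M)).encard ≤ 2 * B := by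
  have hline : (Q.primitiveReps p (p ^ (n + 1) * M) ∩ {v | p ∣ v.2}).encard ≤ B := by
    refine (encard_le_of_subset_image (fun w => (w.1, p * w.2)) ?_).trans
      (encard_splitReps_le hp hpos hB n (hQ.descend hpos ha) (dvd_mul_right p _) hb)
    rintro v ⟨⟨hv, hprim⟩, hv2⟩
    obtain ⟨w, hw, rfl⟩ := exists_descend_apply_eq hp.ne_zero ha hv hv2
    exact ⟨w, ⟨hw, fun h => hprim ⟨h, hv2⟩⟩, rfl⟩
  have hother : (Q.primitiveReps p (p ^ (n + 1) * M) \ {v | p ∣ v.2}).encard ≤ B := by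
    refine (encard_le_of_subset_image Prod.swap ?_).trans
      (encard_splitReps_le hp hpos hB (n + 1) hQ.swap ha hb)
    rintro v ⟨⟨hv, -⟩, hv2⟩
    exact ⟨v.swap, ⟨(swap_apply Q _).trans hv, hv2⟩, v.swap_swap⟩
  rw [← Set.encard_sdiff_add_encard_inter _ {v | p ∣ v.2}, two_mul]
  exact add_le_add hother hline

lemma encard_primitiveReps_le_of_dvd_a (hp : Prime p) (hpos : 0 < p) (hB : RepBound B M) {n : ℕ}
    (ih : ∀ Q : BinaryForm, Q.PosDef → (Q.primitiveReps p (p ^ n * M)).encard ≤ 2 * B)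
    (hQ : Q.PosDef) (ha : p ∣ Q.a) : (Q.primitiveReps p (p ^ (n + 1) * M)).encard ≤ 2 * B := by
  by_cases hb : p ∣ Q.b
  swap
  · exact encard_primitiveReps_le_of_not_dvd_b hp hpos hB n hQ ha hb
  by_cases hc : p ∣ Q.c
  · obtain ⟨_, _, _⟩ := Q
    obtain ⟨⟨a, rfl⟩, ⟨b, rfl⟩, ⟨c, rfl⟩⟩ := And.intro ha (And.intro hb hc)
    have hposDef : PosDef ⟨a, b, c⟩ := by
      refine ⟨pos_of_mul_pos_right hQ.1 hpos.le, sub_pos.1 ?_⟩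
      refine pos_of_mul_pos_right (a := p ^ 2) ?_ (sq_nonneg p)
      linear_combination hQ.2
    refine (Set.encard_le_encard ?_).trans (ih _ hposDef)
    rintro v ⟨hv, hprim⟩
    refine ⟨mul_left_cancel₀ hp.ne_zero ?_, hprim⟩
    linear_combination hv
  · refine (encard_le_of_subset_image (fun w => (w.1, p * w.2)) ?_).trans
      (ih _ (hQ.descend hpos ha))
    rintro v ⟨hv, hprim⟩
    have hdvd : p ∣ p ^ (n + 1) * M := (dvd_pow_self p n.succ_ne_zero).mul_right M
    have hv2 : p ∣ v.2 := by
      refine hp.dvd_of_dvd_pow ((hp.dvd_or_dvd (a := Q.c) (b := v.2 ^ 2) ?_).resolve_left hc)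
      convert dvd_sub hdvd (dvd_add (ha.mul_right (v.1 ^ 2)) (hb.mul_right (v.1 * v.2))) using 1
      linear_combination hv
    obtain ⟨w, hw, rfl⟩ := exists_descend_apply_eq hp.ne_zero ha hv hv2
    exact ⟨w, ⟨hw, fun h => hprim ⟨h.1, hv2⟩⟩, rfl⟩

lemma exists_dvd_a_of_primitive (hp : Prime p) {m : ℤ} (hm : p ∣ m) (hQ : Q.PosDef)
    (hne : (Q.primitiveReps p m).Nonempty) : ∃ Q' : BinaryForm, Q'.PosDef ∧ p ∣ Q'.a ∧
      (Q.primitiveReps p m).encard ≤ (Q'.primitiveReps p m).encard := by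
  obtain ⟨⟨x, y⟩, hv, hprim⟩ := hne
  by_cases hx : p ∣ x
  · refine ⟨Q.swap, hQ.swap, ?_, encard_le_of_subset_image Prod.swap ?_⟩
    · have hy : ¬ p ∣ y := fun hy => hprim ⟨hx, hy⟩
      refine (hp.dvd_or_dvd (b := y ^ 2) ?_).resolve_right fun h => hy (hp.dvd_of_dvd_pow h)
      convert dvd_sub hm (hx.mul_right (Q.a * x + Q.b * y)) using 1
      simp only [swap]
      linear_combination hv
    · rintro v ⟨hv, hprim⟩
      exact ⟨v.swap, ⟨(swap_apply Q _).trans hv, fun h => hprim h.symm⟩, v.swap_swap⟩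
  · obtain ⟨t, ht⟩ := exists_dvd_add_mul hp hx (-y)
    refine ⟨Q.shear t, hQ.shear t, ?_, encard_le_of_subset_image (fun w => (w.1, w.2 + t * w.1)) ?_⟩
    · refine (hp.dvd_or_dvd (a := x ^ 2) ?_).resolve_left fun h => hx (hp.dvd_of_dvd_pow h)
      convert dvd_add hm (ht.mul_right (Q.b * x + Q.c * (x * t + y))) using 1
      simp only [shear]
      linear_combination hv
    · rintro ⟨x, y⟩ ⟨hv, hprim⟩
      refine ⟨(x, y - t * x), ⟨?_, fun h => hprim ⟨h.1, ?_⟩⟩, Prod.ext rfl (sub_add_cancel _ _)⟩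
      · rw [shear_apply, ← hv, sub_add_cancel]
      · exact (dvd_sub_left (h.1.mul_left t)).1 h.2

lemma encard_primitiveReps_le (hp : Prime p) (hpos : 0 < p) (hB : RepBound B M) (n : ℕ)
    (hQ : Q.PosDef) : (Q.primitiveReps p (p ^ n * M)).encard ≤ 2 * B := by
  induction n generalizing Q with
  | zero =>
    rw [pow_zero, one_mul, two_mul]
    exact (Set.encard_le_encard fun v hv => hv.1).trans ((hB Q hQ).trans le_self_add)
  | succ n ih =>
    rcases (Q.primitiveReps p (p ^ (n + 1) * M)).eq_empty_or_nonempty with hempty | hne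
    · rw [hempty, Set.encard_empty]
      exact zero_le
    obtain ⟨Q', hQ', ha, hle⟩ :=
      exists_dvd_a_of_primitive hp ((dvd_pow_self p n.succ_ne_zero).mul_right M) hQ hne
    exact hle.trans (encard_primitiveReps_le_of_dvd_a hp hpos hB (fun _ => ih) hQ' ha)

lemma reps_subset (Q : BinaryForm) (p m : ℤ) :
    Q.reps m ⊆ Q.primitiveReps p m ∪ (p • ·) '' {w | p ^ 2 * Q w = m} := by
  intro v hv
  by_cases hprim : p ∣ v.1 ∧ p ∣ v.2
  · obtain ⟨⟨x, hx⟩, ⟨y, hy⟩⟩ := hprim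
    obtain rfl : v = (p * x, p * y) := Prod.ext hx hy
    refine Or.inr ⟨(x, y), ?_, rfl⟩
    change Q (p * x, p * y) = m at hv
    change p ^ 2 * Q (x, y) = m
    linear_combination hv
  · exact Or.inl ⟨hv, hprim⟩

lemma RepBound.mul_prime_pow (hp : Prime p) (hpos : 0 < p) (hM : ¬ p ∣ M) (hB : RepBound B M)
    (n : ℕ) : RepBound ((n + 1) * B) (p ^ n * M) := by
  induction n using Nat.twoStepInduction with
  | zero => simpa using hB
  | one =>
    intro Q hQ
    refine (Set.encard_le_encard fun v hv => ?_).trans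
      ((encard_primitiveReps_le hp hpos hB 1 hQ).trans_eq (by norm_num))
    refine (reps_subset Q p _ hv).resolve_right ?_
    rintro ⟨w, (hw : p ^ 2 * Q w = p ^ 1 * M), -⟩
    refine hM ⟨Q w, mul_left_cancel₀ hp.ne_zero ?_⟩
    linear_combination -hw
  | more n ih _ =>
    intro Q hQ
    have hdivisible : {w | p ^ 2 * Q w = p ^ (n + 2) * M} ⊆ Q.reps (p ^ n * M) := by
      intro w (hw : p ^ 2 * Q w = p ^ (n + 2) * M)
      refine mul_left_cancel₀ (pow_ne_zero 2 hp.ne_zero) ?_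
      linear_combination hw
    calc (Q.reps (p ^ (n + 2) * M)).encard ≤
          (Q.primitiveReps p (p ^ (n + 2) * M)).encard + (Q.reps (p ^ n * M)).encard := by
          refine (Set.encard_le_encard (reps_subset Q p _)).trans
            ((Set.encard_union_le _ _).trans (add_le_add le_rfl ?_))
          exact (Set.encard_image_le _ _).trans (Set.encard_le_encard hdivisible)
      _ ≤ 2 * B + (n + 1) * B := add_le_add (encard_primitiveReps_le hp hpos hB _ hQ) (ih Q hQ)
      _ = ((n + 2 : ℕ) + 1) * B := by
          push_cast
          ring

end PrimePower

lemma repBound_card_divisors {M : ℕ} (hM : M ≠ 0) : RepBound (8 * M.divisors.card) M := by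
  induction M using Nat.recOnPrimePow with
  | zero => exact absurd rfl hM
  | one => simpa using repBound_one
  | prime_pow_mul M p n hp hpM _ ih =>
    have hcoprime : (p ^ n).Coprime M := ((hp.coprime_iff_not_dvd).2 hpM).pow_left n
    have hbound := (ih (right_ne_zero_of_mul hM)).mul_prime_pow (Nat.prime_iff_prime_int.1 hp)
      (by exact_mod_cast hp.pos) (by exact_mod_cast hpM) n
    convert hbound using 1
    · rw [hcoprime.card_divisors_mul, Nat.divisors_prime_pow hp, Finset.card_map,
        Finset.card_range]
      push_cast
      ring
    · push_cast
      rfl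

end BinaryForm

lemma exists_add_one_le_rpow {δ : ℝ} (hδ : 0 < δ) : ∃ K : ℝ, 1 ≤ K ∧ ∃ P : ℕ, ∀ p n : ℕ, 2 ≤ p →
    (n + 1 : ℝ) ≤ (if p < P then K else 1) * ((p ^ n : ℕ) : ℝ) ^ δ := by
  have hlog : 0 < δ * Real.log 2 := mul_pos hδ (Real.log_pos one_lt_two)
  refine ⟨1 + (δ * Real.log 2)⁻¹, le_add_of_nonneg_right (by positivity),
    ⌈(2 : ℝ) ^ δ⁻¹⌉₊, fun p n hp => ?_⟩
  have hpow : ((p ^ n : ℕ) : ℝ) ^ δ = ((p : ℝ) ^ δ) ^ n := by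
    rw [Nat.cast_pow, ← Real.rpow_natCast, ← Real.rpow_mul p.cast_nonneg, mul_comm,
      Real.rpow_mul p.cast_nonneg, Real.rpow_natCast]
  have hbernoulli {x t : ℝ} (ht : 0 ≤ t) (hx : 1 + t ≤ x) : 1 + n * t ≤ x ^ n :=
    (one_add_mul_le_pow (by linarith) n).trans (pow_le_pow_left₀ (by linarith) hx n)
  rw [hpow]
  split_ifs with hpP
  · have htwo : 1 + δ * Real.log 2 ≤ (p : ℝ) ^ δ := by
      calc 1 + δ * Real.log 2 ≤ Real.exp (Real.log 2 * δ) := by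
            linarith [Real.add_one_le_exp (Real.log 2 * δ)]
        _ = (2 : ℝ) ^ δ := (Real.rpow_def_of_pos two_pos δ).symm
        _ ≤ (p : ℝ) ^ δ := by gcongr; exact_mod_cast hp
    calc (n + 1 : ℝ) ≤ (1 + (δ * Real.log 2)⁻¹) * (1 + n * (δ * Real.log 2)) := by
          have hcancel : (δ * Real.log 2)⁻¹ * (n * (δ * Real.log 2)) = n := by field_simp
          have : 0 ≤ (δ * Real.log 2)⁻¹ + n * (δ * Real.log 2) := by positivity
          linear_combination this - hcancel
      _ ≤ _ := by gcongr; exact hbernoulli hlog.le htwo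
  · have htwo : 1 + 1 ≤ (p : ℝ) ^ δ := by
      calc (1 + 1 : ℝ) = ((2 : ℝ) ^ δ⁻¹) ^ δ := by
            rw [Real.rpow_inv_rpow two_pos.le hδ.ne']
            norm_num
        _ ≤ (p : ℝ) ^ δ := by gcongr; exact Nat.ceil_le.1 (not_lt.1 hpP)
    linarith [hbernoulli zero_le_one htwo]

lemma exists_card_divisors_le_rpow {δ : ℝ} (hδ : 0 < δ) :
    ∃ C : ℝ, 0 < C ∧ ∀ n : ℕ, (n.divisors.card : ℝ) ≤ C * (n : ℝ) ^ δ := by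
  obtain ⟨K, hK, P, hKP⟩ := exists_add_one_le_rpow hδ
  refine ⟨K ^ P, by positivity, fun n => ?_⟩
  rcases eq_or_ne n 0 with rfl | hn
  · simp [hδ.ne']
  have hsmall : ∏ p ∈ n.primeFactors, (if p < P then K else 1) ≤ K ^ P := by
    rw [← Finset.prod_filter, Finset.prod_const]
    refine pow_le_pow_right₀ hK (le_of_le_of_eq (Finset.card_le_card fun p hp => ?_)
      (Finset.card_range P))
    exact Finset.mem_range.2 (Finset.mem_filter.1 hp).2
  calc (n.divisors.card : ℝ) = ∏ p ∈ n.primeFactors, (n.factorization p + 1 : ℝ) := by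
        rw [Nat.card_divisors hn]
        push_cast
        rfl
    _ ≤ ∏ p ∈ n.primeFactors,
          (if p < P then K else 1) * ((p ^ n.factorization p : ℕ) : ℝ) ^ δ :=
        Finset.prod_le_prod (fun p _ => by positivity) fun p hp =>
          hKP p _ (Nat.prime_of_mem_primeFactors hp).two_le
    _ = (∏ p ∈ n.primeFactors, if p < P then K else 1) * (n : ℝ) ^ δ := by
        rw [Finset.prod_mul_distrib, Real.finsetProd_rpow _ _ fun p _ => Nat.cast_nonneg _,
          ← Nat.cast_prod]
        congr 3
        exact Nat.prod_factorization_pow_eq_self hn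
    _ ≤ K ^ P * (n : ℝ) ^ δ := by gcongr

/-! ### Lattice points near two Fermi spheres -/

lemma sum_fin_three (f : Fin 3 → ℤ) (j : Fin 3) : ∑ i, f i = f j + f (j + 1) + f (j + 2) := by
  rw [← Equiv.sum_comp (Equiv.addLeft j), Fin.sum_univ_three]
  simp

lemma lenSq_nonneg (p : Momentum) : 0 ≤ lenSq p := Finset.sum_nonneg fun _ _ => sq_nonneg _

/-- On the plane orthogonal to `k`, the form `(k j)² |u|²` in the coordinates `u (j + 1)` and
`u (j + 2)`. -/
def planeForm (k : Momentum) (j : Fin 3) : BinaryForm :=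
  ⟨k j ^ 2 + k (j + 1) ^ 2, 2 * k (j + 1) * k (j + 2), k j ^ 2 + k (j + 2) ^ 2⟩

lemma planeForm_posDef {k : Momentum} {j : Fin 3} (hj : k j ≠ 0) : (planeForm k j).PosDef := by
  refine ⟨by simp only [planeForm]; positivity, sub_pos.1 ?_⟩
  have hdisc : 4 * (planeForm k j).a * (planeForm k j).c - (planeForm k j).b ^ 2 =
      4 * k j ^ 2 * (k j ^ 2 + k (j + 1) ^ 2 + k (j + 2) ^ 2) := by
    simp only [planeForm]
    ring
  rw [hdisc]
  positivity

lemma planeForm_apply {k u : Momentum} (hu : k ⬝ᵥ u = 0) (j : Fin 3) :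
    planeForm k j (u (j + 1), u (j + 2)) = k j ^ 2 * lenSq u := by
  rw [dotProduct, sum_fin_three _ j] at hu
  rw [lenSq, sum_fin_three _ j]
  simp only [planeForm]
  linear_combination (k (j + 1) * u (j + 1) + k (j + 2) * u (j + 2) - k j * u j) * hu

lemma eq_of_dotProduct_eq {k u v : Momentum} {j : Fin 3} (hj : k j ≠ 0) (h : k ⬝ᵥ u = k ⬝ᵥ v)
    (h₁ : u (j + 1) = v (j + 1)) (h₂ : u (j + 2) = v (j + 2)) : u = v := by
  rw [dotProduct, dotProduct, sum_fin_three _ j, sum_fin_three _ j, h₁, h₂, add_left_inj,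
    add_left_inj] at h
  by_contra hne
  have hpos := lenSq_pos (sub_ne_zero.2 hne)
  rw [lenSq, sum_fin_three _ j] at hpos
  simp [mul_left_cancel₀ hj h, h₁, h₂] at hpos

lemma card_orthogonal_le {k : Momentum} {j : Fin 3} (hj : k j ≠ 0) {m : ℕ} (hm : m ≠ 0)
    {F : Finset Momentum} (hF : ∀ u ∈ F, k ⬝ᵥ u = 0 ∧ lenSq u = m) :
    F.card ≤ 8 * ((k j).natAbs ^ 2 * m).divisors.card := by
  have hrep := BinaryForm.repBound_card_divisors (M := (k j).natAbs ^ 2 * m) (by positivity)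
    _ (planeForm_posDef hj)
  have hcard : (F : Set Momentum).encard ≤
      ((planeForm k j).reps ((k j).natAbs ^ 2 * m : ℕ)).encard := by
    refine Set.encard_le_encard_of_injOn (f := fun u => (u (j + 1), u (j + 2))) (fun u hu => ?_)
      fun u hu v hv huv => ?_
    · change planeForm k j (u (j + 1), u (j + 2)) = _
      rw [planeForm_apply (hF u hu).1, (hF u hu).2]
      push_cast
      rw [sq_abs]
    · rw [Prod.mk.injEq] at huv
      exact eq_of_dotProduct_eq hj ((hF u hu).1.trans (hF v hv).1.symm) huv.1 huv.2
  rw [Set.encard_coe_eq_coe_finsetCard] at hcard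
  exact_mod_cast hcard.trans hrep

lemma exists_card_orthogonal_le {δ : ℝ} (hδ : 0 < δ) :
    ∃ C : ℝ, 0 < C ∧ ∀ k : Momentum, k ≠ 0 → ∀ m : ℤ, ∀ F : Finset Momentum,
      (∀ u ∈ F, k ⬝ᵥ u = 0 ∧ lenSq u = m) → ∀ Y : ℝ, 1 ≤ Y → (lenSq k * m : ℝ) ≤ Y →
        (F.card : ℝ) ≤ C * Y ^ δ := by
  obtain ⟨C, hC, hdiv⟩ := exists_card_divisors_le_rpow hδ
  refine ⟨1 + 8 * C, by positivity, fun k hk m F hF Y hY hmY => ?_⟩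
  have hYδ : 1 ≤ Y ^ δ := Real.one_le_rpow hY hδ.le
  rcases F.eq_empty_or_nonempty with rfl | ⟨u₀, hu₀⟩
  · simp only [Finset.card_empty, Nat.cast_zero]
    positivity
  lift m to ℕ using (hF u₀ hu₀).2 ▸ lenSq_nonneg u₀
  rcases eq_or_ne m 0 with rfl | hm
  · have hF0 : F ⊆ {0} := fun u hu => Finset.mem_singleton.2 <| by
      by_contra h
      exact (lenSq_pos h).ne' (hF u hu).2
    have hcard : (F.card : ℝ) ≤ 1 := by exact_mod_cast Finset.card_le_card hF0
    nlinarith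
  obtain ⟨j, hj⟩ := Function.ne_iff.1 hk
  have hkj : k j ^ 2 ≤ lenSq k :=
    Finset.single_le_sum (f := fun i => k i ^ 2) (fun i _ => sq_nonneg _) (Finset.mem_univ j)
  have hY' : (((k j).natAbs ^ 2 * m : ℕ) : ℝ) ≤ Y := by
    refine le_trans ?_ hmY
    rw [Nat.cast_mul, ← Int.cast_natCast ((k j).natAbs ^ 2), Nat.cast_pow, Int.natCast_natAbs,
      sq_abs]
    exact_mod_cast mul_le_mul_of_nonneg_right (by exact_mod_cast hkj) m.cast_nonneg
  calc (F.card : ℝ) ≤ 8 * ((k j).natAbs ^ 2 * m).divisors.card := by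
        exact_mod_cast card_orthogonal_le hj hm hF
    _ ≤ 8 * (C * Y ^ δ) := by
        gcongr
        exact (hdiv _).trans (by gcongr)
    _ ≤ (1 + 8 * C) * Y ^ δ := by linarith

/-- The multiple `2 |k|² (p - (k · p) |k|⁻² k)` of the component of `p` orthogonal to `k`. -/
def orthogonalPart (k p : Momentum) : Momentum := (2 * lenSq k) • p - (2 * k ⬝ᵥ p) • k

lemma lenSq_eq_dotProduct (p : Momentum) : lenSq p = p ⬝ᵥ p :=
  Finset.sum_congr rfl fun _ _ => sq _

lemma two_mul_dotProduct (k p : Momentum) :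
    2 * k ⬝ᵥ p = lenSq p - lenSq (p - k) + lenSq k := by
  simp only [lenSq_eq_dotProduct, dotProduct_sub, sub_dotProduct, dotProduct_comm p k]
  ring

lemma dotProduct_orthogonalPart (k p : Momentum) : k ⬝ᵥ orthogonalPart k p = 0 := by
  simp only [orthogonalPart, lenSq_eq_dotProduct, dotProduct_sub, dotProduct_smul, smul_eq_mul]
  ring

lemma lenSq_orthogonalPart (k p : Momentum) :
    lenSq (orthogonalPart k p) = 4 * lenSq k ^ 2 * lenSq p - (2 * k ⬝ᵥ p) ^ 2 * lenSq k := by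
  simp only [orthogonalPart, lenSq_eq_dotProduct, dotProduct_sub, sub_dotProduct, dotProduct_smul,
    smul_dotProduct, smul_eq_mul, dotProduct_comm p k]
  ring

lemma orthogonalPart_injOn {k : Momentum} (hk : k ≠ 0) (n : ℤ) :
    Set.InjOn (orthogonalPart k) {p | 2 * k ⬝ᵥ p = n} := by
  rintro p (hp : _ = n) q (hq : _ = n) hpq
  have hD : 2 * lenSq k ≠ 0 := mul_ne_zero two_ne_zero (lenSq_pos hk).ne'
  rw [orthogonalPart, orthogonalPart, hp, hq, sub_left_inj] at hpq
  exact smul_right_injective _ hD hpq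

lemma lenSq_le_of_sub (k p : Momentum) : lenSq k ≤ 2 * (lenSq p + lenSq (p - k)) := by
  have hsq := lenSq_nonneg ((2 : ℤ) • p - k)
  simp only [lenSq_eq_dotProduct, dotProduct_sub, sub_dotProduct, dotProduct_smul,
    smul_dotProduct, smul_eq_mul, dotProduct_comm p k] at hsq ⊢
  linarith

lemma exists_card_sphere_inter_le {δ : ℝ} (hδ : 0 < δ) : ∃ C : ℝ, 0 < C ∧ ∀ k : Momentum, k ≠ 0 →
    ∀ m₁ m₂ : ℤ, ∀ X : ℝ, 1 ≤ X → (m₁ : ℝ) ≤ X → (m₂ : ℝ) ≤ X → ∀ F : Finset Momentum,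
      (∀ p ∈ F, lenSq p = m₁ ∧ lenSq (p - k) = m₂) → (F.card : ℝ) ≤ C * X ^ δ := by
  obtain ⟨C, hC, hcount⟩ := exists_card_orthogonal_le (δ := δ / 4) (by positivity)
  refine ⟨C * 256 ^ (δ / 4), by positivity, fun k hk m₁ m₂ X hX hm₁ hm₂ F hF => ?_⟩
  rcases F.eq_empty_or_nonempty with rfl | ⟨p₀, hp₀⟩
  · simp only [Finset.card_empty, Nat.cast_zero]
    positivity
  set D := lenSq k
  set n := m₁ - m₂ + D
  have hn : ∀ p ∈ F, 2 * k ⬝ᵥ p = n := fun p hp => by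
    rw [two_mul_dotProduct, (hF p hp).1, (hF p hp).2]
  have himage : ∀ u ∈ F.image (orthogonalPart k),
      k ⬝ᵥ u = 0 ∧ lenSq u = 4 * D ^ 2 * m₁ - n ^ 2 * D := by
    simp only [Finset.forall_mem_image]
    intro p hp
    rw [lenSq_orthogonalPart, (hF p hp).1, hn p hp]
    exact ⟨dotProduct_orthogonalPart k p, rfl⟩
  have hD : (D : ℝ) ≤ 4 * X := by
    have h : D ≤ 2 * (m₁ + m₂) := by
      simpa only [(hF p₀ hp₀).1, (hF p₀ hp₀).2] using lenSq_le_of_sub k p₀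
    have : (D : ℝ) ≤ 2 * (m₁ + m₂) := by exact_mod_cast h
    linarith
  have hD0 : (0 : ℝ) ≤ D := by exact_mod_cast lenSq_nonneg k
  have hvalue : (D * (4 * D ^ 2 * m₁ - n ^ 2 * D : ℤ) : ℝ) ≤ 256 * X ^ 4 := by
    push_cast
    calc (D : ℝ) * (4 * D ^ 2 * m₁ - n ^ 2 * D) ≤ 4 * (D : ℝ) ^ 3 * m₁ := by
          linarith [sq_nonneg ((n : ℝ) * D)]
      _ ≤ 4 * (D : ℝ) ^ 3 * X := by gcongr
      _ ≤ 4 * (4 * X) ^ 3 * X := by gcongr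
      _ = 256 * X ^ 4 := by ring
  have hinj : Set.InjOn (orthogonalPart k) F := (orthogonalPart_injOn hk n).mono hn
  rw [← Finset.card_image_of_injOn hinj]
  refine (hcount k hk _ _ himage _ ?_ hvalue).trans_eq ?_
  · linarith [one_le_pow₀ (n := 4) hX]
  · rw [Real.mul_rpow (by norm_num) (by positivity), ← Real.rpow_natCast X,
      ← Real.rpow_mul (by linarith), mul_assoc]
    congr 3
    push_cast
    ring

/-- The momenta with a gap to the Fermi sphere, which are counted by `𝒩_δ`. -/
def IsGapped (kF δ : ℝ) (p : Momentum) : Prop := (particleNumber kF : ℝ) ^ (-δ) < |len p - kF|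

lemma abs_lenSq_sub_le {kF ε : ℝ} (hkF : 0 ≤ kF) (hε : ε ≤ 1 / 3) {p : Momentum}
    (hp : ¬ IsGapped kF (1 / 3 - ε) p) :
    |(lenSq p : ℝ) - kF ^ 2| ≤ 5 * (particleNumber kF : ℝ) ^ ε := by
  have hN := one_le_particleNumber hkF
  set N := (particleNumber kF : ℝ)
  have hgap : |len p - kF| ≤ N ^ (-(1 / 3 - ε)) := not_lt.1 hp
  have hlen : len p + kF ≤ 5 * N ^ (1 / 3 : ℝ) := by
    have hle : N ^ (-(1 / 3 - ε)) ≤ 1 := Real.rpow_le_one_of_one_le_of_nonpos hN (by linarith)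
    have hone : 1 ≤ N ^ (1 / 3 : ℝ) := Real.one_le_rpow hN (by norm_num)
    linarith [kF_le hkF, (abs_le.1 hgap).2]
  have hsum : 0 ≤ len p + kF := add_nonneg (len_nonneg p) hkF
  calc |(lenSq p : ℝ) - kF ^ 2| = |len p - kF| * (len p + kF) := by
        rw [← len_sq, sq_sub_sq, abs_mul, abs_of_nonneg hsum, mul_comm]
    _ ≤ N ^ (-(1 / 3 - ε)) * (5 * N ^ (1 / 3 : ℝ)) := by gcongr
    _ = 5 * N ^ ε := by
        rw [mul_left_comm, ← Real.rpow_add (by linarith)]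
        congr 2
        ring

lemma kF_sq_add_le {kF ε : ℝ} (hkF : 0 ≤ kF) (hε : ε ≤ 1 / 3) :
    kF ^ 2 + 5 * (particleNumber kF : ℝ) ^ ε ≤ 9 * particleNumber kF := by
  have hN := one_le_particleNumber hkF
  set N := (particleNumber kF : ℝ)
  have hrpow {s : ℝ} (hs : s ≤ 1) : N ^ s ≤ N := Real.rpow_le_self_of_one_le hN hs
  have hsq : kF ^ 2 ≤ 4 * N := by
    calc kF ^ 2 ≤ (2 * N ^ (1 / 3 : ℝ)) ^ 2 := by gcongr; exact kF_le hkF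
      _ = 4 * N ^ (2 / 3 : ℝ) := by
          rw [mul_pow, ← Real.rpow_mul_natCast (by linarith)]
          norm_num
      _ ≤ 4 * N := by gcongr; exact hrpow (by norm_num)
  linarith [hrpow (by linarith : ε ≤ 1)]

/-- The values of `|p|²` that momenta close to the Fermi sphere can take. -/
def nearValues (kF ε : ℝ) : Finset ℤ :=
  Finset.Icc ⌈kF ^ 2 - 5 * (particleNumber kF : ℝ) ^ ε⌉ ⌊kF ^ 2 + 5 * (particleNumber kF : ℝ) ^ ε⌋

lemma lenSq_mem_nearValues {kF ε : ℝ} (hkF : 0 ≤ kF) (hε : ε ≤ 1 / 3) {p : Momentum}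
    (hp : ¬ IsGapped kF (1 / 3 - ε) p) : lenSq p ∈ nearValues kF ε := by
  have h := abs_le.1 (abs_lenSq_sub_le hkF hε hp)
  exact Finset.mem_Icc.2 ⟨Int.ceil_le.2 (by linarith), Int.le_floor.2 (by linarith)⟩

lemma card_nearValues_le {kF ε : ℝ} (hkF : 0 ≤ kF) (hε : 0 ≤ ε) :
    ((nearValues kF ε).card : ℝ) ≤ 11 * (particleNumber kF : ℝ) ^ ε := by
  have hNε := one_le_rpow_particleNumber hkF hε
  rw [nearValues, Int.card_Icc, ← Int.cast_natCast (R := ℝ), Int.ofNat_toNat]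
  push_cast
  refine max_le ?_ (by positivity)
  linarith [Int.floor_le (kF ^ 2 + 5 * (particleNumber kF : ℝ) ^ ε),
    Int.le_ceil (kF ^ 2 - 5 * (particleNumber kF : ℝ) ^ ε)]

lemma exists_card_near_le {ε δ : ℝ} (hε0 : 0 ≤ ε) (hε : ε ≤ 1 / 3) (hδ : 0 < δ) :
    ∃ C : ℝ, 0 < C ∧ ∀ kF : ℝ, 0 ≤ kF → ∀ k : Momentum, k ≠ 0 → ∀ F : Finset Momentum,
      (∀ p ∈ F, ¬ IsGapped kF (1 / 3 - ε) p ∧ ¬ IsGapped kF (1 / 3 - ε) (p - k)) →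
        (F.card : ℝ) ≤ C * (particleNumber kF : ℝ) ^ (2 * ε + δ) := by
  obtain ⟨C, hC, hcount⟩ := exists_card_sphere_inter_le hδ
  refine ⟨121 * (C * 9 ^ δ), by positivity, fun kF hkF k hk F hF => ?_⟩
  have hN := one_le_particleNumber hkF
  set N := (particleNumber kF : ℝ)
  set I := nearValues kF ε
  have hmaps : ∀ p ∈ F, (lenSq p, lenSq (p - k)) ∈ I ×ˢ I := fun p hp =>
    Finset.mk_mem_product (lenSq_mem_nearValues hkF hε (hF p hp).1)
      (lenSq_mem_nearValues hkF hε (hF p hp).2)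
  have hle : ∀ m ∈ I, (m : ℝ) ≤ 9 * N := fun m hm =>
    (Int.le_floor.1 (Finset.mem_Icc.1 hm).2).trans (kF_sq_add_le hkF hε)
  have hfiber : ∀ m ∈ I ×ˢ I,
      ((F.filter fun p => (lenSq p, lenSq (p - k)) = m).card : ℝ) ≤ C * (9 * N) ^ δ := by
    intro m hm
    obtain ⟨hm₁, hm₂⟩ := Finset.mem_product.1 hm
    refine hcount k hk m.1 m.2 (9 * N) (by linarith) (hle _ hm₁) (hle _ hm₂) _ fun p hp => ?_
    exact Prod.ext_iff.1 (Finset.mem_filter.1 hp).2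
  calc (F.card : ℝ) = ∑ m ∈ I ×ˢ I,
        ((F.filter fun p => (lenSq p, lenSq (p - k)) = m).card : ℝ) := by
        exact_mod_cast Finset.card_eq_sum_card_fiberwise hmaps
    _ ≤ (I ×ˢ I).card • (C * (9 * N) ^ δ) := Finset.sum_le_card_nsmul _ _ _ hfiber
    _ = (I.card : ℝ) * I.card * (C * (9 * N) ^ δ) := by
        rw [nsmul_eq_mul, Finset.card_product, Nat.cast_mul]
    _ ≤ (11 * N ^ ε) * (11 * N ^ ε) * (C * (9 * N) ^ δ) := by
        have := card_nearValues_le hkF hε0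
        gcongr
    _ = 121 * (C * 9 ^ δ) * N ^ (2 * ε + δ) := by
        rw [Real.mul_rpow (by norm_num) (by linarith), two_mul, Real.rpow_add (by linarith),
          Real.rpow_add (by linarith)]
        ring

/-! ### Hopping terms -/

/-- The coefficients of `a_q^* a_{q+k} ξ`. -/
def hop (k : Momentum) (ξ : Fock) (q : Momentum) (S : Finset Momentum) : ℂ :=
  create q (annihilate (q + k) ξ) S

lemma hop_eq_zero_of_notMem (k : Momentum) (ξ : Fock) {q : Momentum} {S : Finset Momentum}
    (hq : q ∉ S) : hop k ξ q S = 0 := by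
  rw [hop, create_apply, if_neg hq]

lemma norm_hop {k : Momentum} (hk : k ≠ 0) (ξ : Fock) {q : Momentum} {S : Finset Momentum}
    (hq : q ∈ S) :
    ‖hop k ξ q S‖ = if q + k ∈ S then 0 else ‖ξ (insert (q + k) (S.erase q))‖ := by
  have hne : q + k ≠ q := by simpa using hk
  by_cases h : q + k ∈ S <;> simp [hop, create_apply, annihilate_apply, hq, h, hne, norm_fermiSign]

lemma tsum_create_annihilate (P : Momentum → Prop) [DecidablePred P] (k : Momentum) (ξ : Fock)
    (S : Finset Momentum) :
    ∑' p : {p // P p}, create (p.1 - k) (annihilate p.1 ξ) S =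
      ∑ q ∈ S, if P (q + k) then hop k ξ q S else 0 := by
  calc ∑' p : {p // P p}, create (p.1 - k) (annihilate p.1 ξ) S =
        ∑' p, if P p then create (p - k) (annihilate p ξ) S else 0 := by
        refine (tsum_subtype {p | P p} fun p => create (p - k) (annihilate p ξ) S).trans ?_
        simp only [Set.indicator_apply, Set.mem_ofPred_eq]
    _ = ∑' q, if P (q + k) then hop k ξ q S else 0 := by
        rw [← (Equiv.addRight k).tsum_eq]
        simp only [Equiv.coe_addRight, add_sub_cancel_right, hop]
    _ = ∑ q ∈ S, if P (q + k) then hop k ξ q S else 0 :=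
        tsum_eq_sum fun q hq => by rw [hop_eq_zero_of_notMem k ξ hq, ite_self]

lemma nonBosonizableFun_eq (kF : ℝ) (k : Momentum) (ξ : Fock) (S : Finset Momentum) :
    nonBosonizableFun kF k ξ S =
      (∑ q ∈ S, if q + k ∉ fermiBall kF ∧ q ∉ fermiBall kF then hop k ξ q S else 0) -
        ∑ q ∈ S, if q + -k ∈ fermiBall kF ∧ q ∈ fermiBall kF then hop (-k) ξ q S else 0 := by
  have hparticle := tsum_create_annihilate
    (fun p => p ∉ fermiBall kF ∧ p - k ∉ fermiBall kF) k ξ S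
  have hhole := tsum_create_annihilate
    (fun h => h ∈ fermiBall kF ∧ h + k ∈ fermiBall kF) (-k) ξ S
  simp only [add_sub_cancel_right, sub_neg_eq_add, neg_add_cancel_right] at hparticle hhole
  rw [nonBosonizableFun, hparticle, ← hhole]
  congr 1
  let f : Momentum → ℂ := fun h => create (h + k) (annihilate h ξ) S
  exact (Finset.tsum_subtype _ f).symm.trans <|
    (Equiv.subtypeEquivRight fun h => Finset.mem_filter).tsum_eq fun h => f h.1

lemma tsum_sum_eq_tsum_prod {β : Type*} [DecidableEq β] (f : Finset β → β → ENNReal) :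
    ∑' S, ∑ q ∈ S, f S q = ∑' x : Finset β × β, if x.2 ∈ x.1 then f x.1 x.2 else 0 := by
  rw [ENNReal.tsum_prod (f := fun S q => if q ∈ S then f S q else 0)]
  refine tsum_congr fun S => ?_
  rw [tsum_eq_sum (s := S) fun q hq => if_neg hq]
  exact Finset.sum_congr rfl fun q hq => (if_pos hq).symm

/-- The hop from `q + k` to `q` that ends in `S` starts from `insert (q + k) (S.erase q)`, and
different hops start from different pairs of a configuration and a momentum in it. -/
lemma tsum_sum_hop_le (k : Momentum) {f g : Finset Momentum → Momentum → ENNReal}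
    (hf : ∀ S, ∀ q ∈ S, q + k ∈ S → f S q = 0)
    (hfg : ∀ S, ∀ q ∈ S, q + k ∉ S → f S q ≤ g (insert (q + k) (S.erase q)) (q + k)) :
    ∑' S, ∑ q ∈ S, f S q ≤ ∑' T, ∑ p ∈ T, g T p := by
  let A : Set (Finset Momentum × Momentum) := {x | x.2 ∈ x.1 ∧ x.2 + k ∉ x.1}
  let start : A → Finset Momentum × Momentum :=
    fun x => (insert (x.1.2 + k) (x.1.1.erase x.1.2), x.1.2 + k)
  have hstart : Function.Injective start := by
    have hinv (x : A) : ((start x).1.erase (start x).2, (start x).2 - k) =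
        (x.1.1.erase x.1.2, x.1.2) := by
      simp [start, Finset.erase_insert fun h => x.2.2 (Finset.mem_of_mem_erase h)]
    intro x y hxy
    obtain ⟨herase, hmom⟩ := Prod.ext_iff.1 ((hinv x).symm.trans (hxy ▸ hinv y))
    refine Subtype.ext (Prod.ext ?_ hmom)
    rw [← Finset.insert_erase x.2.1, ← Finset.insert_erase y.2.1]
    exact congrArg₂ insert hmom herase
  rw [tsum_sum_eq_tsum_prod, tsum_sum_eq_tsum_prod]
  calc ∑' x : Finset Momentum × Momentum, (if x.2 ∈ x.1 then f x.1 x.2 else 0) =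
        ∑' x : A, f x.1.1 x.1.2 := by
        rw [tsum_subtype A fun x => f x.1 x.2]
        refine tsum_congr fun x => ?_
        by_cases hx : x.2 ∈ x.1 <;> by_cases hxk : x.2 + k ∈ x.1 <;>
          simp [A, hx, hxk, hf]
    _ ≤ ∑' x : A, if (start x).2 ∈ (start x).1 then g (start x).1 (start x).2 else 0 := by
        refine ENNReal.tsum_le_tsum fun x => ?_
        rw [if_pos (Finset.mem_insert_self _ _)]
        exact hfg _ _ x.2.1 x.2.2
    _ ≤ ∑' y : Finset Momentum × Momentum, if y.2 ∈ y.1 then g y.1 y.2 else 0 :=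
        ENNReal.tsum_comp_le_tsum_of_injective hstart fun y => if y.2 ∈ y.1 then g y.1 y.2 else 0

/-- The weight of a hop starting at `p` in a Cauchy–Schwarz estimate over all hops, for
configurations `S`: hops near the Fermi surface cost at most their number `n`, hops from a
momentum in `G` cost `|S|`, and hops to a momentum in `G` cost `|S ∩ G|`. -/
def hopWeight (G : Momentum → Prop) [DecidablePred G] (n : ℝ) (S : Finset Momentum)
    (p : Momentum) : ℝ :=
  n + (if G p then (S.card : ℝ) else 0) + (S.filter G).card

section HopWeight

variable {G : Momentum → Prop} [DecidablePred G] {n : ℝ} {S : Finset Momentum}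

lemma sum_hopWeight (G : Momentum → Prop) [DecidablePred G] (n : ℝ) (S : Finset Momentum) :
    ∑ p ∈ S, hopWeight G n S p = 2 * S.card * (S.filter G).card + n * S.card := by
  simp only [hopWeight, Finset.sum_add_distrib, Finset.sum_const, nsmul_eq_mul,
    ← Finset.sum_filter]
  ring

lemma hopWeight_le {q p : Momentum} (hq : q ∈ S) (hp : p ∉ S) :
    hopWeight G n S p ≤ hopWeight G (n + 1) (insert p (S.erase q)) p := by
  have hcard : (insert p (S.erase q)).card = S.card := by
    rw [Finset.card_insert_of_notMem fun h => hp (Finset.mem_of_mem_erase h),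
      Finset.card_erase_add_one hq]
  have hfilter : (S.filter G).card ≤ ((insert p (S.erase q)).filter G).card + 1 := by
    calc (S.filter G).card ≤ ((S.filter G).erase q).card + 1 :=
        Nat.sub_le_iff_le_add.1 Finset.pred_card_le_card_erase
      _ ≤ ((insert p (S.erase q)).filter G).card + 1 := by
        rw [← Finset.filter_erase]
        gcongr
        exact Finset.subset_insert _ _
  have hfilter' : ((S.filter G).card : ℝ) ≤ ((insert p (S.erase q)).filter G).card + 1 := by
    exact_mod_cast hfilter
  rw [hopWeight, hopWeight, hcard]
  linarith

variable {k : Momentum}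
  (hn : ∀ F : Finset Momentum, (∀ q ∈ F, ¬ G q ∧ ¬ G (q + k)) → (F.card : ℝ) ≤ n)

include hn

lemma hopWeight_pos {q : Momentum} (hq : q ∈ S) : 0 < hopWeight G n S (q + k) := by
  have hn0 : 0 ≤ n := by simpa using hn ∅
  have hS : (0 : ℝ) < S.card := by exact_mod_cast Finset.card_pos.2 ⟨q, hq⟩
  rw [hopWeight]
  by_cases hsource : G (q + k)
  · rw [if_pos hsource]
    positivity
  by_cases htarget : G q
  · have : (0 : ℝ) < (S.filter G).card := by
      exact_mod_cast Finset.card_pos.2 ⟨q, Finset.mem_filter.2 ⟨hq, htarget⟩⟩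
    rw [if_neg hsource]
    positivity
  · have : 1 ≤ n := by simpa [htarget, hsource] using hn {q}
    rw [if_neg hsource]
    positivity

lemma inv_hopWeight_le {q : Momentum} (hq : q ∈ S) :
    (hopWeight G n S (q + k))⁻¹ ≤
      (if ¬ G q ∧ ¬ G (q + k) then n⁻¹ else 0) + (S.card : ℝ)⁻¹ +
        if G q then ((S.filter G).card : ℝ)⁻¹ else 0 := by
  have hn0 : 0 ≤ n := by simpa using hn ∅
  have hS : (0 : ℝ) < S.card := by exact_mod_cast Finset.card_pos.2 ⟨q, hq⟩
  by_cases hsource : G (q + k)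
  · calc (hopWeight G n S (q + k))⁻¹ ≤ (S.card : ℝ)⁻¹ :=
          inv_anti₀ hS (by
            rw [hopWeight, if_pos hsource]
            linarith [(S.filter G).card.cast_nonneg (α := ℝ)])
      _ ≤ _ := by
        rw [if_neg fun h => h.2 hsource, zero_add]
        exact le_add_of_nonneg_right (by positivity)
  by_cases htarget : G q
  · have hpos : (0 : ℝ) < (S.filter G).card := by
      exact_mod_cast Finset.card_pos.2 ⟨q, Finset.mem_filter.2 ⟨hq, htarget⟩⟩
    calc (hopWeight G n S (q + k))⁻¹ ≤ ((S.filter G).card : ℝ)⁻¹ :=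
          inv_anti₀ hpos (by rw [hopWeight, if_neg hsource]; linarith)
      _ ≤ _ := by
        rw [if_pos htarget]
        exact le_add_of_nonneg_left (by positivity)
  · have hone : 1 ≤ n := by simpa [htarget, hsource] using hn {q}
    calc (hopWeight G n S (q + k))⁻¹ ≤ n⁻¹ :=
          inv_anti₀ (by positivity) (by rw [hopWeight, if_neg hsource]; linarith)
      _ ≤ _ := by
        rw [if_pos ⟨htarget, hsource⟩, if_neg htarget, add_zero]
        exact le_add_of_nonneg_right (by positivity)

lemma sum_inv_hopWeight_le (S : Finset Momentum) :
    ∑ q ∈ S, (hopWeight G n S (q + k))⁻¹ ≤ 3 := by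
  have hn0 : 0 ≤ n := by simpa using hn ∅
  set near := S.filter fun q => ¬ G q ∧ ¬ G (q + k)
  calc ∑ q ∈ S, (hopWeight G n S (q + k))⁻¹ ≤ ∑ q ∈ S,
        ((if ¬ G q ∧ ¬ G (q + k) then n⁻¹ else 0) + (S.card : ℝ)⁻¹ +
          if G q then ((S.filter G).card : ℝ)⁻¹ else 0) :=
        Finset.sum_le_sum fun q hq => inv_hopWeight_le hn hq
    _ = near.card * n⁻¹ + S.card * (S.card : ℝ)⁻¹ +
          (S.filter G).card * ((S.filter G).card : ℝ)⁻¹ := by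
        simp only [Finset.sum_add_distrib, Finset.sum_const, nsmul_eq_mul, ← Finset.sum_filter,
          near]
    _ ≤ 1 + 1 + 1 := by
        gcongr ?_ + ?_ + ?_
        · exact div_le_one_of_le₀ (hn near fun q hq => (Finset.mem_filter.1 hq).2) hn0
        · exact mul_inv_le_one
        · exact mul_inv_le_one
    _ = 3 := by norm_num

lemma norm_sum_sq_le_sum_hopWeight (S : Finset Momentum) (z : Momentum → ℂ) :
    ‖∑ q ∈ S, z q‖ ^ 2 ≤ 3 * ∑ q ∈ S, hopWeight G n S (q + k) * ‖z q‖ ^ 2 := by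
  have hpos (q) (hq : q ∈ S) := hopWeight_pos hn hq
  calc ‖∑ q ∈ S, z q‖ ^ 2 ≤ (∑ q ∈ S, ‖z q‖) ^ 2 := by
        gcongr
        exact norm_sum_le _ _
    _ ≤ (∑ q ∈ S, (hopWeight G n S (q + k))⁻¹) *
          ∑ q ∈ S, hopWeight G n S (q + k) * ‖z q‖ ^ 2 :=
        Finset.sum_sq_le_sum_mul_sum_of_sq_le_mul _ (fun q hq => (inv_pos.2 (hpos q hq)).le)
          (fun q hq => mul_nonneg (hpos q hq).le (sq_nonneg _))
          fun q hq => (inv_mul_cancel_left₀ (hpos q hq).ne' _).ge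
    _ ≤ 3 * ∑ q ∈ S, hopWeight G n S (q + k) * ‖z q‖ ^ 2 := by
        gcongr
        · exact Finset.sum_nonneg fun q hq => mul_nonneg (hpos q hq).le (sq_nonneg _)
        · exact sum_inv_hopWeight_le hn S

lemma tsum_norm_sum_hop_le (hk : k ≠ 0) (R : Momentum → Prop) [DecidablePred R] (ξ : Fock) :
    ∑' S, ENNReal.ofReal (‖∑ q ∈ S, if R q then hop k ξ q S else 0‖ ^ 2) ≤
      ∑' T : Finset Momentum, ENNReal.ofReal
        (3 * (2 * T.card * (T.filter G).card + (n + 1) * T.card) * ‖ξ T‖ ^ 2) := by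
  have hn0 : 0 ≤ n := by simpa using hn ∅
  let f : Finset Momentum → Momentum → ℝ :=
    fun S q => 3 * (hopWeight G n S (q + k) * ‖hop k ξ q S‖ ^ 2)
  let g : Finset Momentum → Momentum → ℝ := fun T p => 3 * (hopWeight G (n + 1) T p * ‖ξ T‖ ^ 2)
  have hf (S) (q) (hq : q ∈ S) : 0 ≤ f S q := by
    have := hopWeight_pos hn hq
    positivity
  have hg (T p) : 0 ≤ g T p := by
    simp only [g, hopWeight]
    positivity
  calc _ ≤ ∑' S, ∑ q ∈ S, ENNReal.ofReal (f S q) := by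
        refine ENNReal.tsum_le_tsum fun S => ?_
        rw [← ENNReal.ofReal_sum_of_nonneg (hf S), ← Finset.mul_sum]
        refine ENNReal.ofReal_le_ofReal ((norm_sum_sq_le_sum_hopWeight hn S _).trans ?_)
        gcongr with q hq
        · exact (hopWeight_pos hn hq).le
        · split_ifs <;> simp
    _ ≤ ∑' T, ∑ p ∈ T, ENNReal.ofReal (g T p) := by
        refine tsum_sum_hop_le k (fun S q hq hqk => ?_) fun S q hq hqk => ?_
        · simp [f, norm_hop hk ξ hq, hqk]
        · simp only [f, g, norm_hop hk ξ hq, if_neg hqk]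
          gcongr
          exact hopWeight_le hq hqk
    _ = _ := by
        refine tsum_congr fun T => ?_
        rw [← ENNReal.ofReal_sum_of_nonneg fun p _ => hg T p, ← Finset.mul_sum, ← Finset.sum_mul,
          sum_hopWeight, ← mul_assoc (3 : ℝ)]

end HopWeight

lemma summable_and_tsum_le_of_tsum_ofReal_le {ι : Type*} {f g : ι → ℝ} (hf : ∀ i, 0 ≤ f i)
    (hg0 : ∀ i, 0 ≤ g i) (hg : Summable g)
    (h : ∑' i, ENNReal.ofReal (f i) ≤ ∑' i, ENNReal.ofReal (g i)) :
    Summable f ∧ ∑' i, f i ≤ ∑' i, g i := by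
  rw [← ENNReal.ofReal_tsum_of_nonneg hg0 hg] at h
  have hsummable : Summable f :=
    (ENNReal.summable_toReal (h.trans_lt ENNReal.ofReal_lt_top).ne).congr fun i =>
      ENNReal.toReal_ofReal (hf i)
  rw [← ENNReal.ofReal_tsum_of_nonneg hf hsummable,
    ENNReal.ofReal_le_ofReal_iff (tsum_nonneg hg0)] at h
  exact ⟨hsummable, h⟩

lemma tsum_norm_nonBosonizableFun_le {G : Momentum → Prop} [DecidablePred G] {n : ℝ}
    (hn : ∀ k ≠ 0, ∀ F : Finset Momentum, (∀ q ∈ F, ¬ G q ∧ ¬ G (q + k)) → (F.card : ℝ) ≤ n)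
    (kF : ℝ) {k : Momentum} (hk : k ≠ 0) (ξ : Fock) :
    ∑' S, ENNReal.ofReal (‖nonBosonizableFun kF k ξ S‖ ^ 2) ≤
      ∑' T : Finset Momentum, ENNReal.ofReal
        (12 * (2 * T.card * (T.filter G).card + (n + 1) * T.card) * ‖ξ T‖ ^ 2) := by
  set W := ∑' T : Finset Momentum, ENNReal.ofReal
    (3 * (2 * T.card * (T.filter G).card + (n + 1) * T.card) * ‖ξ T‖ ^ 2) with hW
  have hsub (z w : ℂ) : ENNReal.ofReal (‖z - w‖ ^ 2) ≤
      2 * ENNReal.ofReal (‖z‖ ^ 2) + 2 * ENNReal.ofReal (‖w‖ ^ 2) := by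
    have hreal : ‖z - w‖ ^ 2 ≤ 2 * ‖z‖ ^ 2 + 2 * ‖w‖ ^ 2 := by
      nlinarith [parallelogram_law_with_norm ℝ z w, sq_nonneg ‖z + w‖]
    calc _ ≤ _ := ENNReal.ofReal_le_ofReal hreal
      _ = _ := by
        rw [ENNReal.ofReal_add (by positivity) (by positivity), ENNReal.ofReal_mul zero_le_two,
          ENNReal.ofReal_mul zero_le_two, ENNReal.ofReal_ofNat]
  simp only [nonBosonizableFun_eq]
  calc _ ≤ 2 * W + 2 * W := by
        refine (ENNReal.tsum_le_tsum fun S => hsub _ _).trans ?_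
        rw [ENNReal.tsum_add, ENNReal.tsum_mul_left, ENNReal.tsum_mul_left]
        gcongr
        · exact tsum_norm_sum_hop_le (hn k hk) hk _ ξ
        · exact tsum_norm_sum_hop_le (hn (-k) (neg_ne_zero.2 hk)) (neg_ne_zero.2 hk) _ ξ
    _ = _ := by
        rw [← add_mul, hW, ← ENNReal.tsum_mul_left]
        refine tsum_congr fun T => ?_
        rw [show (2 + 2 : ENNReal) = ENNReal.ofReal 4 by norm_num,
          ← ENNReal.ofReal_mul zero_le_four]
        congr 1
        ring

/-! ### Number operators -/

/-- The expectation value of the operator that is diagonal in the basis of Slater determinants,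
with eigenvalue `c S` on the one with momenta `S`; it is `0` where the series diverges. -/
def diagonalForm (c : Finset Momentum → ℝ) (ξ : Fock) : ℝ := ∑' S, c S * ‖ξ S‖ ^ 2

/-- The form domain of `(𝒩 + 1)³`. -/
def numberCubedDomain : Set Fock :=
  {ξ | Summable fun S : Finset Momentum => ((S.card : ℝ) + 1) ^ 3 * ‖ξ S‖ ^ 2}

lemma hasSum_norm_annihilate (p : Momentum) (ξ : Fock) :
    HasSum (fun S => if p ∈ S then ‖ξ S‖ ^ 2 else 0) (‖annihilate p ξ‖ ^ 2) := by
  have hinner := (lp.hasSum_inner (𝕜 := ℂ) ξ (create p (annihilate p ξ))).mapL Complex.reCLM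
  rw [create, ContinuousLinearMap.adjoint_inner_right, inner_self_eq_norm_sq_to_K, ← create]
    at hinner
  norm_cast at hinner
  refine hinner.congr_fun fun S => ?_
  rw [create_annihilate_apply]
  split_ifs
  · rw [Complex.reCLM_apply, inner_self_eq_norm_sq_to_K]
    norm_cast
  · simp

lemma tsum_norm_annihilate_sq (Q : Momentum → Prop) [DecidablePred Q] (ξ : Fock) :
    ∑' p : {p // Q p}, ‖annihilate p.1 ξ‖ ^ 2 =
      diagonalForm (fun S => (S.filter Q).card) ξ := by
  have hmode (p : Momentum) : ENNReal.ofReal (‖annihilate p ξ‖ ^ 2) =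
      ∑' S, if p ∈ S then ENNReal.ofReal (‖ξ S‖ ^ 2) else 0 := by
    have hsum := hasSum_norm_annihilate p ξ
    rw [← hsum.tsum_eq, ENNReal.ofReal_tsum_of_nonneg (fun S => by positivity) hsum.summable]
    simp only [apply_ite ENNReal.ofReal, ENNReal.ofReal_zero]
  have hswap : ∑' p : {p // Q p}, ENNReal.ofReal (‖annihilate p.1 ξ‖ ^ 2) =
      ∑' S, ENNReal.ofReal ((S.filter Q).card * ‖ξ S‖ ^ 2) := by
    simp only [hmode]
    rw [ENNReal.tsum_comm]
    refine tsum_congr fun S => ?_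
    rw [tsum_eq_sum (s := S.subtype Q) fun p hp => if_neg (by simpa using hp),
      Finset.sum_congr rfl fun p hp => if_pos (Finset.mem_subtype.1 hp), Finset.sum_const,
      Finset.card_subtype, nsmul_eq_mul, ENNReal.ofReal_mul (Nat.cast_nonneg _),
      ENNReal.ofReal_natCast]
  have htoReal := congrArg ENNReal.toReal hswap
  rw [ENNReal.tsum_toReal_eq fun _ => ENNReal.ofReal_ne_top,
    ENNReal.tsum_toReal_eq fun _ => ENNReal.ofReal_ne_top] at htoReal
  refine Eq.trans ?_ (htoReal.trans ?_)
  · exact tsum_congr fun p => (ENNReal.toReal_ofReal (by positivity)).symm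
  · exact tsum_congr fun S => ENNReal.toReal_ofReal (by positivity)

lemma numberForm_nonneg (ξ : Fock) : 0 ≤ numberForm ξ := tsum_nonneg fun _ => sq_nonneg _

lemma numberForm_eq (ξ : Fock) : numberForm ξ = diagonalForm (fun S => S.card) ξ := by
  have htrue := tsum_norm_annihilate_sq (fun _ => True) ξ
  simp only [Finset.filter_true] at htrue
  rw [← htrue, numberForm]
  exact ((Equiv.subtypeUnivEquiv fun _ : Momentum => trivial).tsum_eq
    fun p => ‖annihilate p ξ‖ ^ 2).symm

lemma mem_numberCubedDomain {kF : ℝ} {ξ : Fock} (hξ : ξ ∈ balancedSector kF) :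
    ξ ∈ numberCubedDomain := by
  refine .of_nonneg_of_le (fun S => by positivity) (fun S => ?_)
    ((summable_fock ξ).mul_left ((2 * particleNumber kF + 1 : ℝ) ^ 3))
  by_cases hS : ξ S = 0
  · simp [hS]
  have hholes : (S.filter (· ∈ fermiBall kF)).card ≤ particleNumber kF :=
    Finset.card_le_card fun p hp => (Finset.mem_filter.1 hp).2
  have hcard : S.card ≤ 2 * particleNumber kF := by
    have := Finset.card_filter_add_card_filter_not (s := S) (· ∈ fermiBall kF)
    have := hξ S hS
    omega
  gcongr
  exact_mod_cast hcard

section Diagonal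

variable {ξ : Fock} {a b c : Finset Momentum → ℝ}

lemma summable_of_le_numberCubed (hξ : ξ ∈ numberCubedDomain) (hc0 : ∀ S, 0 ≤ c S)
    (hc : ∀ S : Finset Momentum, c S ≤ ((S.card : ℝ) + 1) ^ 3) :
    Summable fun S => c S * ‖ξ S‖ ^ 2 :=
  .of_nonneg_of_le (fun S => mul_nonneg (hc0 S) (sq_nonneg _))
    (fun S => mul_le_mul_of_nonneg_right (hc S) (sq_nonneg _)) hξ

lemma diagonalForm_le_sqrt_mul_sqrt (ha0 : ∀ S, 0 ≤ a S) (hb0 : ∀ S, 0 ≤ b S)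
    (ha : Summable fun S => a S * ‖ξ S‖ ^ 2) (hb : Summable fun S => b S * ‖ξ S‖ ^ 2)
    (hc : ∀ S, c S ^ 2 ≤ a S * b S) :
    diagonalForm c ξ ≤ √(diagonalForm a ξ) * √(diagonalForm b ξ) := by
  have hsq {d : Finset Momentum → ℝ} (hd : ∀ S, 0 ≤ d S) (S) :
      √(d S * ‖ξ S‖ ^ 2) ^ (2 : ℝ) = d S * ‖ξ S‖ ^ 2 := by
    rw [Real.rpow_two, Real.sq_sqrt (mul_nonneg (hd S) (sq_nonneg _))]
  obtain ⟨hsum, hle⟩ := Real.summable_and_inner_le_Lp_mul_Lq_tsum_of_nonneg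
    Real.HolderConjugate.two_two (f := fun S => √(a S * ‖ξ S‖ ^ 2))
    (g := fun S => √(b S * ‖ξ S‖ ^ 2)) (fun S => Real.sqrt_nonneg _) (fun S => Real.sqrt_nonneg _)
    (by simpa only [hsq ha0] using ha) (by simpa only [hsq hb0] using hb)
  simp only [hsq ha0, hsq hb0, ← Real.sqrt_eq_rpow] at hle
  refine (Real.le_norm_self _).trans ((tsum_of_norm_bounded hsum.hasSum fun S => ?_).trans hle)
  rw [← Real.sqrt_mul (mul_nonneg (ha0 S) (sq_nonneg _)), Real.norm_eq_abs]
  refine Real.abs_le_sqrt ?_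
  calc (c S * ‖ξ S‖ ^ 2) ^ 2 = c S ^ 2 * (‖ξ S‖ ^ 2) ^ 2 := mul_pow _ _ _
    _ ≤ a S * b S * (‖ξ S‖ ^ 2) ^ 2 := by
      gcongr
      exact hc S
    _ = a S * ‖ξ S‖ ^ 2 * (b S * ‖ξ S‖ ^ 2) := by ring

end Diagonal

lemma diagonalForm_card_mul_card_filter_le (G : Momentum → Prop) [DecidablePred G] {ξ : Fock}
    (hξ : ξ ∈ numberCubedDomain) :
    diagonalForm (fun S => S.card * (S.filter G).card) ξ ≤
      √(numberCubedForm ξ) * √(diagonalForm (fun S => (S.filter G).card) ξ) := by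
  have hG (S : Finset Momentum) : ((S.filter G).card : ℝ) ≤ S.card := by
    exact_mod_cast Finset.card_filter_le _ _
  have hcube (S : Finset Momentum) : (S.card : ℝ) ^ 2 * (S.filter G).card ≤
      ((S.card : ℝ) + 1) ^ 3 := by
    calc (S.card : ℝ) ^ 2 * (S.filter G).card ≤ (S.card + 1) ^ 2 * (S.card + 1) := by
          gcongr
          · linarith
          · linarith [hG S]
      _ = ((S.card : ℝ) + 1) ^ 3 := by ring
  refine diagonalForm_le_sqrt_mul_sqrt (fun S => by positivity) (fun S => Nat.cast_nonneg _) hξ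
    (summable_of_le_numberCubed hξ (fun S => Nat.cast_nonneg _) fun S => ?_) fun S => ?_
  · calc ((S.filter G).card : ℝ) ≤ S.card + 1 := by linarith [hG S]
      _ ≤ ((S.card : ℝ) + 1) ^ 3 := le_self_pow₀ (by simp) three_ne_zero
  · calc ((S.card : ℝ) * (S.filter G).card) ^ 2 =
          (S.card : ℝ) ^ 2 * (S.filter G).card * (S.filter G).card := by ring
      _ ≤ ((S.card : ℝ) + 1) ^ 3 * (S.filter G).card := by
        gcongr
        exact hcube S

/-! ### Bounds on `ℰ₁` and `ℰ₂` -/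

/-- `d(0) = 𝒩_p - 𝒩_h`. -/
lemma nonBosonizableFun_zero {kF : ℝ} {ξ : Fock} (hξ : ξ ∈ balancedSector kF) :
    nonBosonizableFun kF 0 ξ = 0 := by
  funext S
  have hhop (q) (hq : q ∈ S) : hop 0 ξ q S = ξ S := by
    rw [hop, add_zero, create_annihilate_apply, if_pos hq]
  have hcount (R : Momentum → Prop) [DecidablePred R] :
      ∑ q ∈ S, (if R q then hop 0 ξ q S else 0) = (S.filter R).card * ξ S := by
    rw [← Finset.sum_filter, Finset.sum_congr rfl fun q hq => hhop q (Finset.mem_filter.1 hq).1,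
      Finset.sum_const, nsmul_eq_mul]
  rw [nonBosonizableFun_eq]
  simp only [neg_zero, add_zero, and_self, hcount]
  by_cases hS : ξ S = 0
  · simp [hS]
  · simp [hξ S hS]

section NonBosonizable

variable {G : Momentum → Prop} [DecidablePred G] {n : ℝ}
  (hn : ∀ k ≠ 0, ∀ F : Finset Momentum, (∀ q ∈ F, ¬ G q ∧ ¬ G (q + k)) → (F.card : ℝ) ≤ n)

include hn

lemma norm_nonBosonizable_sq_le (kF : ℝ) {k : Momentum} (hk : k ≠ 0) {ξ : Fock}
    (hξ : ξ ∈ numberCubedDomain) :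
    ξ ∈ nonBosonizableDomain kF k ∧
      ‖nonBosonizable kF k ξ‖ ^ 2 ≤
        24 * (√(numberCubedForm ξ) * √(diagonalForm (fun S => (S.filter G).card) ξ)) +
          12 * (n + 1) * numberForm ξ := by
  have hn0 : 0 ≤ n := by simpa using hn k hk ∅
  have hcube (S : Finset Momentum) {m : ℕ} (hm : m ≤ 3) :
      (S.card : ℝ) ^ m ≤ (S.card + 1) ^ 3 :=
    (pow_le_pow_left₀ (Nat.cast_nonneg _) (by linarith) m).trans (pow_le_pow_right₀ (by simp) hm)
  have hprod := summable_of_le_numberCubed hξ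
    (c := fun S => S.card * (S.filter G).card) (fun S => by positivity) fun S => by
      refine le_trans ?_ (hcube S (Nat.le_succ 2))
      rw [sq]
      gcongr
      exact Finset.filter_subset _ _
  have hnumber := summable_of_le_numberCubed hξ (c := fun S => S.card) (fun S => by positivity)
    fun S => by simpa using hcube S (Nat.succ_pos 2)
  have hsplit := (hprod.hasSum.mul_left 24).add (hnumber.hasSum.mul_left (12 * (n + 1)))
  have hweight := hsplit.congr_fun (g := fun T : Finset Momentum =>
    12 * (2 * T.card * (T.filter G).card + (n + 1) * T.card) * ‖ξ T‖ ^ 2) fun T => by ring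
  obtain ⟨hsum, hle⟩ := summable_and_tsum_le_of_tsum_ofReal_le (fun S => by positivity)
    (fun T => by positivity) hweight.summable (tsum_norm_nonBosonizableFun_le hn kF hk ξ)
  refine ⟨memℓp_two hsum, ?_⟩
  rw [nonBosonizable, dif_pos (memℓp_two hsum), norm_sq_fock]
  calc _ ≤ 24 * diagonalForm (fun S => S.card * (S.filter G).card) ξ +
          12 * (n + 1) * diagonalForm (fun S => S.card) ξ := hle.trans hweight.tsum_eq.le
    _ ≤ _ := by
      rw [← numberForm_eq]
      gcongr
      exact diagonalForm_card_mul_card_filter_le G hξ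

lemma E1Form_le {V : Momentum → ℝ} (hV : Summable V) (hV0 : ∀ k, 0 ≤ V k) {kF : ℝ} {ξ : Fock}
    (hξ : ξ ∈ balancedSector kF) :
    ξ ∈ E1Domain V kF ∧
      E1Form V kF ξ ≤ (∑' k, V k) * (particleNumber kF : ℝ)⁻¹ *
        (12 * (√(numberCubedForm ξ) * √(diagonalForm (fun S => (S.filter G).card) ξ)) +
          6 * (n + 1) * numberForm ξ) := by
  have hn0 : 0 ≤ n := by simpa using hn (fun _ => 1) (by simp [funext_iff]) ∅
  set B := 12 * (√(numberCubedForm ξ) * √(diagonalForm (fun S => (S.filter G).card) ξ)) +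
    6 * (n + 1) * numberForm ξ with hB
  have hnumber := numberForm_nonneg ξ
  have hbound (k : Momentum) :
      ξ ∈ nonBosonizableDomain kF k ∧ ‖nonBosonizable kF k ξ‖ ^ 2 ≤ 2 * B := by
    rcases eq_or_ne k 0 with rfl | hk
    · have hmem : Memℓp (nonBosonizableFun kF 0 ξ) 2 := nonBosonizableFun_zero hξ ▸ zero_memℓp
      refine ⟨hmem, ?_⟩
      rw [nonBosonizable, dif_pos hmem, norm_sq_fock]
      simp only [nonBosonizableFun_zero hξ, Pi.zero_apply, norm_zero, zero_pow two_ne_zero,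
        tsum_zero]
      positivity
    · obtain ⟨hmem, hle⟩ := norm_nonBosonizable_sq_le hn kF hk (mem_numberCubedDomain hξ)
      exact ⟨hmem, hle.trans_eq (by rw [hB]; ring)⟩
  have hle (k : Momentum) : V k * ‖nonBosonizable kF k ξ‖ ^ 2 ≤ V k * (2 * B) :=
    mul_le_mul_of_nonneg_left (hbound k).2 (hV0 k)
  have hsum : Summable fun k => V k * ‖nonBosonizable kF k ξ‖ ^ 2 :=
    .of_nonneg_of_le (fun k => mul_nonneg (hV0 k) (sq_nonneg _)) hle (hV.mul_right _)
  refine ⟨⟨fun k _ => (hbound k).1, hsum⟩, ?_⟩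
  calc E1Form V kF ξ ≤ 1 / (2 * (particleNumber kF : ℝ)) * ∑' k, V k * (2 * B) := by
        rw [E1Form]
        exact mul_le_mul_of_nonneg_left (hsum.tsum_le_tsum hle (hV.mul_right _)) (by positivity)
    _ = (∑' k, V k) * (particleNumber kF : ℝ)⁻¹ * B := by
        rw [tsum_mul_right, one_div, mul_inv]
        ring

lemma E1Form_add_E2Form_ge {V : Momentum → ℝ} (hV : Summable V) (hV0 : ∀ k, 0 ≤ V k) {kF : ℝ}
    (hkF : 0 ≤ kF) {s : ℝ} (hs : 0 < s) {ξ : Fock} (hξ : ξ ∈ balancedSector kF)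
    (hkin : ξ ∈ kineticDomain kF) :
    ξ ∈ E1Domain V kF ∧ Summable (fun k => V k * couplingForm kF k ξ) ∧
      -(s * ((∑' k, V k) * (particleNumber kF : ℝ)⁻¹ *
        (12 * (√(numberCubedForm ξ) * √(diagonalForm (fun S => (S.filter G).card) ξ)) +
          6 * (n + 1) * numberForm ξ))) - 5292 * (∑' k, V k) * s⁻¹ * kineticForm kF ξ ≤
        E1Form V kF ξ + E2Form V kF ξ := by
  obtain ⟨hdom, hE1⟩ := E1Form_le hn hV hV0 hξ
  have hE1_nonneg : 0 ≤ E1Form V kF ξ :=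
    mul_nonneg (by positivity) (tsum_nonneg fun k => mul_nonneg (hV0 k) (sq_nonneg _))
  obtain ⟨hsum, hE2⟩ := abs_E2Form_le hV hV0 hkF hs hdom hkin
  refine ⟨hdom, hsum, ?_⟩
  linarith [neg_le_of_abs_le hE2, mul_le_mul_of_nonneg_left hE1 hs.le]

end NonBosonizable

open Classical in
lemma gappedNumberForm_eq (kF δ : ℝ) (ξ : Fock) :
    gappedNumberForm kF δ ξ = diagonalForm (fun S => (S.filter (IsGapped kF δ)).card) ξ :=
  tsum_norm_annihilate_sq (IsGapped kF δ) ξ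

theorem exists_abs_E2Form_le {V : Momentum → ℝ} (hV : Summable V) (hV0 : ∀ k, 0 ≤ V k) :
    ∃ C : ℝ, 0 < C ∧ ∀ kF : ℝ, 0 ≤ kF → ∀ α : ℝ,
      ∀ ξ : Fock, ξ ∈ E1Domain V kF → ξ ∈ kineticDomain kF →
        Summable (fun k => V k * couplingForm kF k ξ) ∧
        |E2Form V kF ξ| ≤ (particleNumber kF : ℝ) ^ α * E1Form V kF ξ
          + C * (particleNumber kF : ℝ) ^ (-α) * kineticForm kF ξ := by
  have hv : 0 ≤ ∑' k, V k := tsum_nonneg hV0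
  refine ⟨5292 * (∑' k, V k) + 1, by positivity, fun kF hkF α ξ hE1 hkin => ?_⟩
  have hN : (0 : ℝ) < particleNumber kF := one_pos.trans_le (one_le_particleNumber hkF)
  obtain ⟨hsum, hle⟩ := abs_E2Form_le hV hV0 hkF (Real.rpow_pos_of_pos hN α) hE1 hkin
  refine ⟨hsum, hle.trans ?_⟩
  have hkinetic := kineticForm_nonneg kF ξ
  rw [Real.rpow_neg hN.le]
  gcongr
  linarith

/-- A bound `N^{2ε+δ}` on the number of hops near the Fermi surface, with `δ = γ/3 - ε`, turns
`N^{ε/4} N^{-1}` into exactly `N^{5ε/4+γ/3-1}`. -/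
theorem exists_E1Form_add_E2Form_ge {γ ε : ℝ} (hε : 0 < ε) (hε' : ε ≤ 1 / 3) (hγ : ε < γ / 3)
    {V : Momentum → ℝ} (hV : Summable V) (hV0 : ∀ k, 0 ≤ V k) :
    ∃ C : ℝ, 0 < C ∧ ∀ kF : ℝ, 0 ≤ kF →
      ∀ ξ : Fock, ξ ∈ balancedSector kF → ξ ∈ kineticDomain kF →
        ξ ∈ E1Domain V kF ∧
        Summable (fun k => V k * couplingForm kF k ξ) ∧
        E1Form V kF ξ + E2Form V kF ξ ≥
          -(C * (particleNumber kF : ℝ) ^ (-1 + ε / 4) * √(numberCubedForm ξ)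
              * √(gappedNumberForm kF (1 / 3 - ε) ξ))
          - C * (particleNumber kF : ℝ) ^ (5 * ε / 4 + γ / 3 - 1) * numberForm ξ
          - C * (particleNumber kF : ℝ) ^ (-(ε / 4)) * kineticForm kF ξ := by
  classical
  obtain ⟨C, hC, hnear⟩ := exists_card_near_le hε.le hε' (sub_pos.2 hγ)
  set v := ∑' k, V k
  have hv : 0 ≤ v := tsum_nonneg hV0
  refine ⟨5292 * v * (C + 1) + 1, by positivity, fun kF hkF ξ hξ hkin => ?_⟩
  have hN : (0 : ℝ) < particleNumber kF := one_pos.trans_le (one_le_particleNumber hkF)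
  have hn (k : Momentum) (hk : k ≠ 0) (F : Finset Momentum)
      (hF : ∀ q ∈ F, ¬ IsGapped kF (1 / 3 - ε) q ∧ ¬ IsGapped kF (1 / 3 - ε) (q + k)) :
      (F.card : ℝ) ≤ C * (particleNumber kF : ℝ) ^ (2 * ε + (γ / 3 - ε)) :=
    hnear kF hkF (-k) (neg_ne_zero.2 hk) F (by simpa only [sub_neg_eq_add] using hF)
  have hcount := one_le_rpow_particleNumber hkF (by linarith : 0 ≤ 2 * ε + (γ / 3 - ε))
  have hs := Real.rpow_pos_of_pos hN (ε / 4)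
  obtain ⟨hdom, hsum, hge⟩ := E1Form_add_E2Form_ge hn hV hV0 hkF hs hξ hkin
  refine ⟨hdom, hsum, ?_⟩
  have hnumber := numberForm_nonneg ξ
  have hkinetic := kineticForm_nonneg kF ξ
  rw [← gappedNumberForm_eq] at hge
  rw [show 5 * ε / 4 + γ / 3 - 1 = -1 + ε / 4 + (2 * ε + (γ / 3 - ε)) by ring,
    Real.rpow_add hN (-1 + ε / 4), Real.rpow_add hN, Real.rpow_neg_one, Real.rpow_neg hN.le]
  set N := (particleNumber kF : ℝ)
  set X := N ^ (2 * ε + (γ / 3 - ε))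
  set s := N ^ (ε / 4)
  set A := √(numberCubedForm ξ) * √(gappedNumberForm kF (1 / 3 - ε) ξ) with hA
  set D := 5292 * v * (C + 1) + 1
  have hvC : 0 ≤ v * C := by positivity
  have hcubed : 12 * v * (N⁻¹ * s * A) ≤ D * (N⁻¹ * s * A) := by
    gcongr
    linarith
  have hcard : 6 * v * (C * X + 1) ≤ D * X := by
    nlinarith [mul_le_mul_of_nonneg_left hcount hv, mul_nonneg hvC (zero_le_one.trans hcount)]
  have hnear' : 6 * v * (C * X + 1) * (N⁻¹ * s * numberForm ξ) ≤
      D * X * (N⁻¹ * s * numberForm ξ) := by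
    gcongr
  have hkinetic' : 5292 * v * (s⁻¹ * kineticForm kF ξ) ≤ D * (s⁻¹ * kineticForm kF ξ) := by
    gcongr
    linarith
  rw [mul_assoc _ √(numberCubedForm ξ), ← hA]
  linarith

end FermiGas

end

open FermiGas in
theorem corollary4p7_general :
    (∀ V : Momentum → ℝ, Summable V → (∀ k, 0 ≤ V k) →
      ∃ C : ℝ, 0 < C ∧ ∀ kF : ℝ, 0 ≤ kF → ∀ α : ℝ,
        ∀ ξ : Fock, ξ ∈ E1Domain V kF → ξ ∈ kineticDomain kF →
          Summable (fun k => V k * couplingForm kF k ξ) ∧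
          E2Form V kF ξ ≤ (particleNumber kF : ℝ) ^ α * E1Form V kF ξ
            + C * (particleNumber kF : ℝ) ^ (-α) * kineticForm kF ξ ∧
          -E2Form V kF ξ ≤ (particleNumber kF : ℝ) ^ α * E1Form V kF ξ
            + C * (particleNumber kF : ℝ) ^ (-α) * kineticForm kF ξ) ∧
    (∀ γ ε : ℝ, 0 < ε → ε ≤ 1 / 3 → ε < γ / 3 →
      ∀ V : Momentum → ℝ, Summable V → (∀ k, 0 ≤ V k) →
        ∃ C : ℝ, 0 < C ∧ ∀ kF : ℝ, 0 ≤ kF →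
          ∀ ξ : Fock, ξ ∈ balancedSector kF → ξ ∈ kineticDomain kF →
            ξ ∈ E1Domain V kF ∧
            Summable (fun k => V k * couplingForm kF k ξ) ∧
            E1Form V kF ξ + E2Form V kF ξ ≥
              -(C * (particleNumber kF : ℝ) ^ (-1 + ε / 4) * √(numberCubedForm ξ)
                  * √(gappedNumberForm kF (1 / 3 - ε) ξ))
              - C * (particleNumber kF : ℝ) ^ (5 * ε / 4 + γ / 3 - 1) * numberForm ξ
              - C * (particleNumber kF : ℝ) ^ (-(ε / 4)) * kineticForm kF ξ) := by
  refine ⟨fun V hV hV0 => ?_, fun γ ε hε hε' hγ V hV hV0 =>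
    exists_E1Form_add_E2Form_ge hε hε' hγ hV hV0⟩
  obtain ⟨C, hC, hbound⟩ := exists_abs_E2Form_le hV hV0
  refine ⟨C, hC, fun kF hkF α ξ hE1 hkin => ?_⟩
  obtain ⟨hsum, habs⟩ := hbound kF hkF α ξ hE1 hkin
  exact ⟨hsum, (le_abs_self _).trans habs, (neg_le_abs _).trans habs⟩

open FermiGas in
theorem corollary4p7 :
    (∀ V : Momentum → ℝ, Summable V → (∀ k, 0 ≤ V k) →
      ∃ C : ℝ, 0 < C ∧ ∀ kF : ℝ, 0 < kF → ∀ α : ℝ, 0 ≤ α →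
        ∀ ξ : Fock, ξ ∈ E1Domain V kF → ξ ∈ kineticDomain kF →
          Summable (fun k => V k * couplingForm kF k ξ) ∧
          E2Form V kF ξ ≤ (particleNumber kF : ℝ) ^ α * E1Form V kF ξ
            + C * (particleNumber kF : ℝ) ^ (-α) * kineticForm kF ξ ∧
          -E2Form V kF ξ ≤ (particleNumber kF : ℝ) ^ α * E1Form V kF ξ
            + C * (particleNumber kF : ℝ) ^ (-α) * kineticForm kF ξ) ∧
    (∀ γ : ℝ, 131 / 208 < γ → γ < 1 →
      ∃ ε₀ : ℝ, 0 < ε₀ ∧ ∀ ε : ℝ, 0 < ε → ε < ε₀ →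
        ∀ V : Momentum → ℝ, Summable V → (∀ k, 0 ≤ V k) →
          ∃ C : ℝ, 0 < C ∧ ∀ kF : ℝ, 0 < kF →
            ∀ ξ : Fock, ξ ∈ balancedSector kF → ξ ∈ kineticDomain kF →
              ξ ∈ E1Domain V kF ∧
              Summable (fun k => V k * couplingForm kF k ξ) ∧
              E1Form V kF ξ + E2Form V kF ξ ≥
                -(C * (particleNumber kF : ℝ) ^ (-1 + ε / 4) * √(numberCubedForm ξ)
                    * √(gappedNumberForm kF (1 / 3 - ε) ξ))
                - C * (particleNumber kF : ℝ) ^ (5 * ε / 4 + γ / 3 - 1) * numberForm ξ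
                - C * (particleNumber kF : ℝ) ^ (-(ε / 4)) * kineticForm kF ξ) := by
  obtain ⟨hE2, hE1E2⟩ := corollary4p7_general
  refine ⟨fun V hV hV0 => ?_, fun γ hγ hγ1 => ⟨γ / 3, by linarith, fun ε hε hεγ V hV hV0 => ?_⟩⟩
  · obtain ⟨C, hC, hbound⟩ := hE2 V hV hV0
    exact ⟨C, hC, fun kF hkF α _ => hbound kF hkF.le α⟩
  · obtain ⟨C, hC, hbound⟩ := hE1E2 γ ε hε (by linarith) hεγ V hV hV0
    exact ⟨C, hC, fun kF hkF => hbound kF hkF.le⟩
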